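/- Let $d\ge 1$, $\mathbb{T}^d=(\mathbb{R}/\mathbb{Z})^d$, $s\in(0,1)$ and $T>0$. For $-T\le a<b\le T$ let $\mathcal{A}^*(\mathbb{T}^d,(a,b))$ be the set of finite positive measures $\mu=\mu_t\otimes dt$ on $\mathbb{T}^d\times(a,b)$ such that for a.e. $t$ the measure $\mu_t=\sum_i\varphi_i(t)\delta_{X_i(t)}$ is a countable sum of Dirac masses, and such that there is a finite $\mathbb{R}^d$-valued measure $m\ll\mu$ with $\partial_t\mu+\nabla\cdot m=0$ in the sense of distributions on $\mathbb{T}^d\times(a,b)$. Put $$I(\mu,(a,b))=\inf_m\left\{\int_a^b\sum_{x\,:\,\mu_t(\{x\})>0}\mu_t(\{x\})^{\frac{d-1}{d}}\,dt+\int_{\mathbb{T}^d\times(a,b)}\left|\frac{dm}{d\mu}\right|^2d\mu\right\}\in[0,\infty],$$ the infimum being over all such $m$. Let $\mathcal{A}_T^*=\mathcal{A}^*(\mathbb{T}^d,(-T,T))$, and for $\mu\in\mathcal{A}_T^*$ let $\mu_{\pm T}$ be the weak limits of $\mu_t$ as $t\to\pm T$ (up to a Lebesgue null set of times $t$). For $r\in\mathbb{R}$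 and a finite signed measure $\sigma$ on $\mathbb{T}^d$ let $$\|\sigma\|_{\dot H^{-r}}^2=\sum_{k\in\mathbb{Z}^d}|k|^{-2r}|\widehat\sigma_k|^2\in[0,\infty],\qquad \widehat\sigma_k=\int_{\mathbb{T}^d}e^{2\pi i k\cdot x}\,d\sigma(x),$$ where for $r>0$ the term $k=0$ is read as $\infty$ if $\widehat\sigma_0\neq0$ and as $0$ if $\widehat\sigma_0=0$. Writing $1$ for the Lebesgue measure on $\mathbb{T}^d$, define for $\mu\in\mathcal{A}_T^*$ $$E_{s,T}(\mu)=I(\mu,(-T,T))+\|\mu_T-1\|_{\dot H^{-s}}^2+\|\mu_{-T}-1\|_{\dot H^{-s}}^2 .$$ Let $\mu$ be a minimizer of $E_{s,T}$ in $\mathcal{A}_T^*$ that is symmetric with respect to $t=0$ (that is, $\mu_{-t}=\mu_t$ for a.e. $t$), and assume that for some $\beta\in(0,1)$ $$\limsup_{\varepsilon\to0^+}\varepsilon^{-\beta}I(\mu,(T-\varepsilon,T))<\infty.$$ Then $$\|\mu_T-1\|_{\dot H^{-\frac12(2-\alpha)}}<\infty\qquad\text{for all real }\alpha<2(1-s)+\frac{2\beta}{1+\beta}.$$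 -/

import Mathlib

open MeasureTheory ProbabilityTheory Filter Topology
open scoped ENNReal ContDiff

namespace BranchedTransport

noncomputable section

/-! A measure `μ = μ_t ⊗ dt` on `𝕋^d × (a, b)` is represented by the measurable family `t ↦ μ_t`
of its slices, a kernel from `ℝ` to the torus. All notions below only depend on the slices for
almost every `t ∈ (a, b)`. In space-time, the time variable comes first. -/

/-- The space-time measure `μ_t ⊗ dt` on `(a, b) × 𝕋^d`. -/
def spaceTime {d : ℕ} (μ : Kernel ℝ (UnitAddTorus (Fin d))) (a b : ℝ) :
    Measure (ℝ × UnitAddTorus (Fin d)) :=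
  (volume.restrict (Set.Ioo a b)).compProd μ

/-- Smooth real test functions with compact support in `(a, b) × 𝕋^d`; smoothness is that of the
periodic lift to `ℝ × ℝ^d`. -/
structure IsTest {d : ℕ} (a b : ℝ) (ψ : ℝ × UnitAddTorus (Fin d) → ℝ) : Prop where
  smooth : ContDiff ℝ ∞
    (fun p : ℝ × (Fin d → ℝ) => ψ (p.1, fun i => ((p.2 i : ℝ) : UnitAddCircle)))
  compact : HasCompactSupport ψ
  support : tsupport ψ ⊆ Set.Ioo a b ×ˢ Set.univ

/-- The time derivative `∂_t ψ`. -/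
def timeDeriv {d : ℕ} (ψ : ℝ × UnitAddTorus (Fin d) → ℝ)
    (p : ℝ × UnitAddTorus (Fin d)) : ℝ :=
  deriv (fun h : ℝ => ψ (p.1 + h, p.2)) 0

/-- The spatial partial derivative `∂_j ψ`. -/
def spaceDeriv {d : ℕ} (ψ : ℝ × UnitAddTorus (Fin d) → ℝ) (j : Fin d)
    (p : ℝ × UnitAddTorus (Fin d)) : ℝ :=
  deriv (fun h : ℝ => ψ (p.1, p.2 + Pi.single j ((h : ℝ) : UnitAddCircle))) 0

/-- `v = dm/dμ` for a finite `ℝ^d`-valued measure `m ≪ μ` on `𝕋^d × (a, b)` with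
`∂_t μ + ∇ · m = 0` in the sense of distributions. By Radon-Nikodym, the finite vector measures
`m ≪ μ` are exactly the measures `m = v μ` with `v` integrable. -/
structure IsVelocity {d : ℕ} (μ : Kernel ℝ (UnitAddTorus (Fin d))) (a b : ℝ)
    (v : ℝ × UnitAddTorus (Fin d) → EuclideanSpace ℝ (Fin d)) : Prop where
  integrable : Integrable v (spaceTime μ a b)
  continuity_eq : ∀ ψ : ℝ × UnitAddTorus (Fin d) → ℝ, IsTest a b ψ →
    ∫ p, (timeDeriv ψ p + ∑ j : Fin d, spaceDeriv ψ j p * v p j) ∂(spaceTime μ a b) = 0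

/-- A measure on the torus of the form `∑ᵢ φᵢ δ_{Xᵢ}`, with finitely or countably many terms. -/
def IsAtomic {d : ℕ} (ν : Measure (UnitAddTorus (Fin d))) : Prop :=
  ∃ S : Set (UnitAddTorus (Fin d)), S.Countable ∧ ν Sᶜ = 0

/-- The class `𝒜*(𝕋^d, (a, b))` of admissible measures. -/
structure Admissible {d : ℕ} (a b : ℝ) (μ : Kernel ℝ (UnitAddTorus (Fin d))) : Prop where
  finite : IsFiniteKernel μ
  atomic : ∀ᵐ t ∂(volume.restrict (Set.Ioo a b)), IsAtomic (μ t)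
  exists_velocity : ∃ v, IsVelocity μ a b v

/-- `∑_x ν({x})^{(d-1)/d}`, the sum being over the atoms of `ν`. -/
def slicePerimeter {d : ℕ} (ν : Measure (UnitAddTorus (Fin d))) : ℝ≥0∞ :=
  ∑' x : {x : UnitAddTorus (Fin d) // ν {x} ≠ 0}, (ν {x.1}) ^ (((d : ℝ) - 1) / (d : ℝ))

/-- The perimeter part `P(μ, (a, b))` of the internal energy. -/
def perimeter {d : ℕ} (μ : Kernel ℝ (UnitAddTorus (Fin d))) (a b : ℝ) : ℝ≥0∞ :=
  ∫⁻ t in Set.Ioo a b, slicePerimeter (μ t)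

/-- The kinetic part `∫ |dm/dμ|² dμ` of the internal energy. -/
def kinetic {d : ℕ} (μ : Kernel ℝ (UnitAddTorus (Fin d))) (a b : ℝ)
    (v : ℝ × UnitAddTorus (Fin d) → EuclideanSpace ℝ (Fin d)) : ℝ≥0∞ :=
  ∫⁻ p, ‖v p‖ₑ ^ 2 ∂(spaceTime μ a b)

/-- The internal energy `I(μ, (a, b))`: the least value of `I(μ, m, (a, b))` over all `m = v μ`
that solve the continuity equation. -/
def internalEnergy {d : ℕ} (μ : Kernel ℝ (UnitAddTorus (Fin d))) (a b : ℝ) : ℝ≥0∞ :=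
  ⨅ v : ℝ × UnitAddTorus (Fin d) → EuclideanSpace ℝ (Fin d), ⨅ _ : IsVelocity μ a b v,
    (perimeter μ a b + kinetic μ a b v)

/-- `ρ` is the weak limit of `μ_t` as `t` tends to an end point along `l`, up to a Lebesgue null
set of times `t`. -/
def IsTrace {d : ℕ} (μ : Kernel ℝ (UnitAddTorus (Fin d))) (l : Filter ℝ)
    (ρ : Measure (UnitAddTorus (Fin d))) : Prop :=
  IsFiniteMeasure ρ ∧ ∀ f : C(UnitAddTorus (Fin d), ℝ),
    Tendsto (fun t => ∫ x, f x ∂(μ t)) (l ⊓ ae (volume : Measure ℝ)) (𝓝 (∫ x, f x ∂ρ))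

open Classical in
/-- The trace of `μ` along `l` (and the zero measure if there is none, in which case the boundary
term below is infinite, because the zero measure does not have mass one). -/
def trace {d : ℕ} (μ : Kernel ℝ (UnitAddTorus (Fin d))) (l : Filter ℝ) :
    Measure (UnitAddTorus (Fin d)) :=
  if h : ∃ ρ, IsTrace μ l ρ then h.choose else 0

/-- The boundary measure `μ_T` for `μ` on `(-T, T)`. -/
def traceTop {d : ℕ} (T : ℝ) (μ : Kernel ℝ (UnitAddTorus (Fin d))) :
    Measure (UnitAddTorus (Fin d)) :=
  trace μ (𝓝[<] T)

/-- The boundary measure `μ_{-T}` for `μ` on `(-T, T)`. -/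
def traceBot {d : ℕ} (T : ℝ) (μ : Kernel ℝ (UnitAddTorus (Fin d))) :
    Measure (UnitAddTorus (Fin d)) :=
  trace μ (𝓝[>] (-T))

/-- The Euclidean length `|k|` of a frequency `k ∈ ℤ^d`. -/
def freqNorm {d : ℕ} (k : Fin d → ℤ) : ℝ≥0∞ :=
  ENNReal.ofReal (Real.sqrt (∑ i, (k i : ℝ) ^ 2))

/-- The squared norm `‖ρ - 1‖²` in `Ḣ^{-r}(𝕋^d)`, where `1` is the Lebesgue measure, as the sum
over `k` of `|k|^{-2r} |σ̂_k|²` with `σ = ρ - 1` and `σ̂_k = ∫ exp(2πi k·x) dσ(x)`. In `[0, ∞]` the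
weight at `k = 0` is `∞` for `0 < r`, so that finiteness of the sum forces `ρ` to have mass `1`. -/
def deviationSq {d : ℕ} (r : ℝ) (ρ : Measure (UnitAddTorus (Fin d))) : ℝ≥0∞ :=
  ∑' k : Fin d → ℤ, freqNorm k ^ (-2 * r) *
    ‖(∫ x, UnitAddTorus.mFourier k x ∂ρ) -
      ∫ x, UnitAddTorus.mFourier k x ∂(volume : Measure (UnitAddTorus (Fin d)))‖ₑ ^ 2

/-- The total energy `E_{s,T}(μ) = I(μ, (-T, T)) + ‖μ_T - 1‖² + ‖μ_{-T} - 1‖²`, with the norms of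
`Ḣ^{-s}`. -/
def totalEnergy {d : ℕ} (s T : ℝ) (μ : Kernel ℝ (UnitAddTorus (Fin d))) : ℝ≥0∞ :=
  internalEnergy μ (-T) T + (deviationSq s (traceTop T μ) + deviationSq s (traceBot T μ))

/-- `μ` minimizes `E_{s,T}` in the class `𝒜*_T`. -/
def IsMinimizer {d : ℕ} (s T : ℝ) (μ : Kernel ℝ (UnitAddTorus (Fin d))) : Prop :=
  Admissible (-T) T μ ∧
    ∀ ν : Kernel ℝ (UnitAddTorus (Fin d)), Admissible (-T) T ν →
      totalEnergy s T μ ≤ totalEnergy s T ν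

/-- `μ` on `(-T, T)` is symmetric with respect to `t = 0`. -/
def IsSymmetric {d : ℕ} (T : ℝ) (μ : Kernel ℝ (UnitAddTorus (Fin d))) : Prop :=
  ∀ᵐ t ∂(volume.restrict (Set.Ioo (-T) T)), μ (-t) = μ t

end

end BranchedTransport

/-!
Let `μ` be a minimizer and `h` a vector. In the time layer `(T - ε, T)` replace `μ_t` by the
average of its translates by `w(t) h` and `-w(t) h`, where `w` increases smoothly from `0` to `1`.
This competitor is a `splitKernel`, and the comparison with it proves the theorem.

* The perimeter at most doubles in the layer, by subadditivity of `m ↦ m^((d-1)/d)`, so it grows by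
  at most `P(μ, (T - ε, T)) ≤ C ε^β`.
* The kinetic energy grows by at most `C |h|² / ε`, since the terms mixing the old velocity with
  `±w' h` cancel in the average (`exists_isVelocity_splitKernel`).
* The Fourier coefficients `σ̂_k` of `μ_T - 1` are multiplied by `cos (2π k·h)`
  (`devCoeff_splitKernel`), so the boundary term decreases by `∑ |k|^(-2s) |σ̂_k|² sin² (2π k·h)`.

By minimality this sum is at most `C ε^β + C |h|² / ε`, and `ε = |h|^(2/(1+β))` bounds it by a
multiple of `|h|^(2β/(1+β))` (`IsMinimizer.exists_tsum_sin_le_rpow`). Taking `h = η e_j` and adding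
up over the directions `j` and the dyadic scales `η = 2⁻ⁿ / 8` shows that
`∑ |k|^(q - 2s) |σ̂_k|²` is finite for every `q < 2β/(1+β)` (`tsum_rpow_freqNorm_ne_top`), which is
the claim.

The terms of the comparison can only be cancelled if the energy of `μ` is finite, and for this one
needs an admissible measure of finite energy. It is a branching tree whose traces are Lebesgue
measure: the particle with end point `u ∈ (0, 1]^d` moves through the dyadic approximations of `u`,
and passes from the `j`-th to the next while `|t|` increases and `T² - t²` decreases from `T² 3⁻ʲ`
to `T² 3⁻ʲ⁻¹`.
During this period there are at most `2^(d(j+1))` particles, so the perimeter contributes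
`O((2/3)^j)`, and the speed is `O((3/2)^j)`, so the kinetic energy contributes `O((3/4)^j)`.

Both competitors are given by moving particles. Their Eulerian velocity field is the conditional
expectation of the particle velocity given the position in space-time, and Jensen's inequality
bounds its kinetic energy (`exists_isVelocity_of_lift`).
-/

namespace BranchedTransport

noncomputable section

/-! ### Test functions on the torus and their periodic lifts -/

section

/-- The covering map `ℝ^d → 𝕋^d`. -/
def torusMk {d : ℕ} (y : Fin d → ℝ) : UnitAddTorus (Fin d) := fun i => (y i : UnitAddCircle)

variable {d : ℕ} {a b : ℝ} {ψ : ℝ × UnitAddTorus (Fin d) → ℝ}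

lemma torusMk_add (y z : Fin d → ℝ) : torusMk (y + z) = torusMk y + torusMk z := by
  ext i; simp [torusMk]

lemma torusMk_single (j : Fin d) (h : ℝ) :
    torusMk (Pi.single j h) = Pi.single j (h : UnitAddCircle) := by
  ext i
  by_cases hij : i = j
  · subst hij; simp [torusMk]
  · simp [torusMk, hij]

lemma continuous_torusMk : Continuous (torusMk (d := d)) :=
  continuous_pi fun i => (AddCircle.continuous_mk' 1).comp (continuous_apply i)

lemma isOpenQuotientMap_torusMk : IsOpenQuotientMap (torusMk (d := d)) :=
  IsOpenQuotientMap.piMap fun _ => QuotientAddGroup.isOpenQuotientMap_mk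

lemma isOpenQuotientMap_prodMap_torusMk :
    IsOpenQuotientMap (Prod.map (id : ℝ → ℝ) (torusMk (d := d))) :=
  IsOpenQuotientMap.id.prodMap isOpenQuotientMap_torusMk

lemma torusMk_surjective : Function.Surjective (torusMk (d := d)) :=
  isOpenQuotientMap_torusMk.surjective

/-- The periodic lift of a function on `ℝ × 𝕋^d`. -/
def periodicLift (ψ : ℝ × UnitAddTorus (Fin d) → ℝ) (p : ℝ × (Fin d → ℝ)) : ℝ :=
  ψ (p.1, torusMk p.2)

lemma IsTest.contDiff_lift (hψ : IsTest a b ψ) : ContDiff ℝ ∞ (periodicLift ψ) := hψ.smooth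

lemma IsTest.hasFDerivAt_lift (hψ : IsTest a b ψ) (p : ℝ × (Fin d → ℝ)) :
    HasFDerivAt (periodicLift ψ) (fderiv ℝ (periodicLift ψ) p) p :=
  ((hψ.contDiff_lift.differentiable (by simp)) p).hasFDerivAt

lemma IsTest.timeDeriv_eq (hψ : IsTest a b ψ) (t : ℝ) (y : Fin d → ℝ) :
    timeDeriv ψ (t, torusMk y) = fderiv ℝ (periodicLift ψ) (t, y) (1, 0) := by
  have h1 : HasDerivAt (fun h : ℝ => (t + h, y)) ((1 : ℝ), (0 : Fin d → ℝ)) 0 :=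
    ((hasDerivAt_id (0 : ℝ)).const_add t).prodMk (hasDerivAt_const (0 : ℝ) y)
  have h2 := (hψ.hasFDerivAt_lift (t + 0, y)).comp_hasDerivAt (0 : ℝ) h1
  rw [add_zero] at h2
  exact h2.deriv

lemma IsTest.spaceDeriv_eq (hψ : IsTest a b ψ) (j : Fin d) (t : ℝ) (y : Fin d → ℝ) :
    spaceDeriv ψ j (t, torusMk y) = fderiv ℝ (periodicLift ψ) (t, y) (0, Pi.single j 1) := by
  have h0 : HasDerivAt (fun h : ℝ => y + Pi.single j h) (Pi.single j (1 : ℝ)) 0 := by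
    refine HasDerivAt.const_add y ?_
    rw [hasDerivAt_pi]
    intro i
    by_cases hij : i = j
    · subst hij; simpa using hasDerivAt_id' (0 : ℝ)
    · simpa [hij] using hasDerivAt_const (0 : ℝ) (0 : ℝ)
  have h1 : HasDerivAt (fun h : ℝ => (t, y + Pi.single j h))
      ((0 : ℝ), (Pi.single j 1 : Fin d → ℝ)) 0 :=
    (hasDerivAt_const (0 : ℝ) t).prodMk h0
  have h2 := (hψ.hasFDerivAt_lift (t, y + Pi.single j 0)).comp_hasDerivAt (0 : ℝ) h1
  have h3 : (periodicLift ψ ∘ fun h : ℝ => (t, y + Pi.single j h))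
      = fun h : ℝ => ψ (t, torusMk y + Pi.single j (h : UnitAddCircle)) := by
    funext h
    simp [periodicLift, torusMk_add, torusMk_single]
  rw [h3, Pi.single_zero, add_zero] at h2
  exact h2.deriv

/-- The chain rule for a test function along a curve, in terms of its derivatives on the torus. -/
lemma IsTest.hasDerivAt_comp (hψ : IsTest a b ψ) {y : ℝ → Fin d → ℝ} {y' : Fin d → ℝ} {t : ℝ}
    (hy : HasDerivAt y y' t) :
    HasDerivAt (fun τ => ψ (τ, torusMk (y τ)))
      (timeDeriv ψ (t, torusMk (y t)) + ∑ j, spaceDeriv ψ j (t, torusMk (y t)) * y' j) t := by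
  have h1 : HasDerivAt (fun τ : ℝ => (τ, y τ)) ((1 : ℝ), y') t := (hasDerivAt_id t).prodMk hy
  have h2 := (hψ.hasFDerivAt_lift (t, y t)).comp_hasDerivAt t h1
  refine h2.congr_deriv ?_
  have h3 : ((1 : ℝ), y') = (1, 0) + ∑ j, y' j • ((0 : ℝ), (Pi.single j 1 : Fin d → ℝ)) := by
    ext i
    · simp [Prod.fst_sum]
    · simp [Prod.snd_sum, Finset.sum_apply, Pi.single_apply]
  rw [h3, map_add, map_sum, hψ.timeDeriv_eq]
  simp only [hψ.spaceDeriv_eq, map_smul, smul_eq_mul, mul_comm]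

lemma IsTest.continuous_fderiv_lift (hψ : IsTest a b ψ) (e : ℝ × (Fin d → ℝ)) :
    Continuous fun p => fderiv ℝ (periodicLift ψ) p e :=
  (hψ.contDiff_lift.continuous_fderiv (by simp)).clm_apply continuous_const

lemma IsTest.continuous_timeDeriv (hψ : IsTest a b ψ) : Continuous (timeDeriv ψ) := by
  refine isOpenQuotientMap_prodMap_torusMk.isQuotientMap.continuous_iff.2 ?_
  refine (hψ.continuous_fderiv_lift (1, 0)).congr fun p => ?_
  exact (hψ.timeDeriv_eq p.1 p.2).symm

lemma IsTest.continuous_spaceDeriv (hψ : IsTest a b ψ) (j : Fin d) :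
    Continuous (spaceDeriv ψ j) := by
  refine isOpenQuotientMap_prodMap_torusMk.isQuotientMap.continuous_iff.2 ?_
  refine (hψ.continuous_fderiv_lift (0, Pi.single j 1)).congr fun p => ?_
  exact (hψ.spaceDeriv_eq j p.1 p.2).symm

lemma timeDeriv_eq_zero {p : ℝ × UnitAddTorus (Fin d)} (hp : p ∉ tsupport ψ) :
    timeDeriv ψ p = 0 := by
  have h := notMem_tsupport_iff_eventuallyEq.1 hp
  have hc : Tendsto (fun h : ℝ => (p.1 + h, p.2)) (𝓝 0) (𝓝 p) := by
    have : Continuous (fun h : ℝ => (p.1 + h, p.2)) := by fun_prop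
    simpa using this.tendsto 0
  have h2 : (fun h : ℝ => ψ (p.1 + h, p.2)) =ᶠ[𝓝 0] fun _ => 0 := hc.eventually h
  rw [timeDeriv, h2.deriv_eq]
  simp

lemma spaceDeriv_eq_zero {p : ℝ × UnitAddTorus (Fin d)} (hp : p ∉ tsupport ψ) (j : Fin d) :
    spaceDeriv ψ j p = 0 := by
  have h := notMem_tsupport_iff_eventuallyEq.1 hp
  have hc : Tendsto (fun h : ℝ => (p.1, p.2 + Pi.single j (h : UnitAddCircle))) (𝓝 0) (𝓝 p) := by
    have : Continuous (fun h : ℝ => (p.1, p.2 + Pi.single j (h : UnitAddCircle))) := by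
      simp_rw [← torusMk_single]
      exact continuous_const.prodMk (continuous_const.add
        (continuous_torusMk.comp (continuous_single (A := fun _ : Fin d => ℝ) j)))
    simpa using this.tendsto 0
  have h2 : (fun h : ℝ => ψ (p.1, p.2 + Pi.single j (h : UnitAddCircle))) =ᶠ[𝓝 0] fun _ => 0 :=
    hc.eventually h
  rw [spaceDeriv, h2.deriv_eq]
  simp

lemma IsTest.bounded_timeDeriv (hψ : IsTest a b ψ) : ∃ C, ∀ p, ‖timeDeriv ψ p‖ ≤ C :=
  (HasCompactSupport.intro hψ.compact fun _ hp => timeDeriv_eq_zero hp).exists_bound_of_continuous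
    hψ.continuous_timeDeriv

/-- The shear `(t, x) ↦ (t, x + g t)` of space-time. -/
def shear {g : ℝ → Fin d → ℝ} (hg : Continuous g) :
    ℝ × UnitAddTorus (Fin d) ≃ₜ ℝ × UnitAddTorus (Fin d) where
  toFun p := (p.1, p.2 + torusMk (g p.1))
  invFun p := (p.1, p.2 - torusMk (g p.1))
  left_inv p := by simp
  right_inv p := by simp
  continuous_toFun := by
    have := continuous_torusMk (d := d)
    fun_prop
  continuous_invFun := by
    have := continuous_torusMk (d := d)
    fun_prop

/-- Test functions are stable under smooth shears. -/
lemma IsTest.comp_shear (hψ : IsTest a b ψ) {g : ℝ → Fin d → ℝ} (hg : ContDiff ℝ ∞ g) :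
    IsTest a b (fun p => ψ (p.1, p.2 + torusMk (g p.1))) where
  smooth := by
    have h : ContDiff ℝ ∞ (fun p : ℝ × (Fin d → ℝ) => (p.1, p.2 + g p.1)) :=
      contDiff_fst.prodMk (contDiff_snd.add (hg.comp contDiff_fst))
    have h2 := hψ.contDiff_lift.comp h
    simp only [Function.comp_def, periodicLift, torusMk_add] at h2
    exact h2
  compact := hψ.compact.comp_homeomorph (shear hg.continuous)
  support := by
    intro p hp
    have h2 := tsupport_comp_subset_preimage ψ (shear hg.continuous).continuous hp
    have h3 := hψ.support h2
    exact ⟨h3.1, trivial⟩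

lemma IsTest.timeDeriv_comp_shear (hψ : IsTest a b ψ) {g : ℝ → Fin d → ℝ} {g' : Fin d → ℝ}
    {p : ℝ × UnitAddTorus (Fin d)} (hg : HasDerivAt g g' p.1) :
    timeDeriv (fun p => ψ (p.1, p.2 + torusMk (g p.1))) p =
      timeDeriv ψ (p.1, p.2 + torusMk (g p.1)) +
        ∑ j, spaceDeriv ψ j (p.1, p.2 + torusMk (g p.1)) * g' j := by
  obtain ⟨t, x⟩ := p
  obtain ⟨y, rfl⟩ := torusMk_surjective x
  have h1 := hψ.hasDerivAt_comp (hg.const_add y)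
  have h2 : HasDerivAt (fun h : ℝ => ψ (t + h, torusMk (y + g (t + h))))
      (timeDeriv ψ (t, torusMk (y + g t)) +
        ∑ j, spaceDeriv ψ j (t, torusMk (y + g t)) * g' j) 0 := by
    have := HasDerivAt.comp_const_add t 0 (by simpa using h1)
    simpa using this
  simpa only [timeDeriv, torusMk_add] using h2.deriv

lemma spaceDeriv_comp_shear (g : ℝ → Fin d → ℝ) (j : Fin d) (p : ℝ × UnitAddTorus (Fin d)) :
    spaceDeriv (fun p => ψ (p.1, p.2 + torusMk (g p.1))) j p =
      spaceDeriv ψ j (p.1, p.2 + torusMk (g p.1)) := by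
  simp only [spaceDeriv, add_right_comm]

end

/-! ### From Lagrangian to Eulerian velocities -/

section

variable {d : ℕ} {a b : ℝ} {ψ : ℝ × UnitAddTorus (Fin d) → ℝ}

instance isFiniteMeasure_spaceTime (μ : Kernel ℝ (UnitAddTorus (Fin d))) [IsFiniteKernel μ] :
    IsFiniteMeasure (spaceTime μ a b) := by
  unfold spaceTime; infer_instance

/-- The spatial gradient of a test function, as a vector of the Euclidean space. -/
def spaceGrad (ψ : ℝ × UnitAddTorus (Fin d) → ℝ) (p : ℝ × UnitAddTorus (Fin d)) :
    EuclideanSpace ℝ (Fin d) :=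
  WithLp.toLp 2 fun j => spaceDeriv ψ j p

lemma inner_spaceGrad (p : ℝ × UnitAddTorus (Fin d)) (v : EuclideanSpace ℝ (Fin d)) :
    inner ℝ (spaceGrad ψ p) v = ∑ j, spaceDeriv ψ j p * v j := by
  simp [spaceGrad, PiLp.inner_apply, mul_comm]

lemma IsTest.continuous_spaceGrad (hψ : IsTest a b ψ) : Continuous (spaceGrad ψ) :=
  (PiLp.continuous_toLp 2 _).comp (continuous_pi hψ.continuous_spaceDeriv)

lemma spaceGrad_hasCompactSupport (hψ : IsTest a b ψ) : HasCompactSupport (spaceGrad ψ) := by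
  refine HasCompactSupport.intro hψ.compact fun p hp => ?_
  ext j
  simp [spaceGrad, spaceDeriv_eq_zero hp j]

lemma IsTest.bounded_spaceGrad (hψ : IsTest a b ψ) : ∃ C, ∀ p, ‖spaceGrad ψ p‖ ≤ C :=
  (spaceGrad_hasCompactSupport hψ).exists_bound_of_continuous hψ.continuous_spaceGrad

section Lift

variable {Θ : Type*} [MeasurableSpace Θ] {Q : Measure Θ}
  {Φ : Θ → ℝ × UnitAddTorus (Fin d)} {w : Θ → EuclideanSpace ℝ (Fin d)}

lemma IsTest.integrable_timeDeriv [IsFiniteMeasure Q] (hψ : IsTest a b ψ) (hΦ : Measurable Φ) :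
    Integrable (fun θ => timeDeriv ψ (Φ θ)) Q := by
  obtain ⟨C, hC⟩ := hψ.bounded_timeDeriv
  exact Integrable.of_bound (hψ.continuous_timeDeriv.measurable.comp hΦ).aestronglyMeasurable C
    (ae_of_all _ fun θ => hC _)

lemma IsTest.integrable_inner (hψ : IsTest a b ψ) (hΦ : Measurable Φ) (hw : Integrable w Q) :
    Integrable (fun θ => inner ℝ (spaceGrad ψ (Φ θ)) (w θ)) Q := by
  obtain ⟨C, hC⟩ := hψ.bounded_spaceGrad
  have hm : AEStronglyMeasurable (fun θ => spaceGrad ψ (Φ θ)) Q :=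
    (hψ.continuous_spaceGrad.measurable.comp hΦ).aestronglyMeasurable
  refine Integrable.mono' (hw.norm.const_mul C) (hm.inner hw.1) (ae_of_all _ fun θ => ?_)
  exact (norm_inner_le_norm _ _).trans (mul_le_mul_of_nonneg_right (hC _) (norm_nonneg _))

/-- A Lagrangian description of `ν` with velocities `w ∈ L²` gives an Eulerian velocity field: the
conditional expectation of `w` given the position in space-time. By Jensen's inequality this does
not increase the kinetic energy. -/
theorem exists_isVelocity_of_lift [IsFiniteMeasure Q] {ν : Kernel ℝ (UnitAddTorus (Fin d))}
    (hΦ : Measurable Φ) (hmap : Q.map Φ = spaceTime ν a b) (hw : MemLp w 2 Q)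
    (hce : ∀ ψ, IsTest a b ψ →
      ∫ θ, (timeDeriv ψ (Φ θ) + ∑ j, spaceDeriv ψ j (Φ θ) * w θ j) ∂Q = 0) :
    ∃ v, IsVelocity ν a b v ∧ kinetic ν a b v ≤ ∫⁻ θ, ‖w θ‖ₑ ^ 2 ∂Q := by
  have hwi : Integrable w Q := hw.integrable one_le_two
  -- the conditional expectation is a function of `Φ`, and this function is the velocity field
  obtain ⟨v, hvm, hv⟩ := (stronglyMeasurable_condExp
    (μ := Q) (m := .comap Φ inferInstance) (f := w)).exists_eq_measurable_comp
  have hvint : Integrable (v ∘ Φ) Q := hv ▸ integrable_condExp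
  refine ⟨v, ⟨?_, fun ψ hψ => ?_⟩, ?_⟩
  · rw [← hmap]
    exact (integrable_map_measure hvm.aestronglyMeasurable hΦ.aemeasurable).2 hvint
  · simp only [← inner_spaceGrad] at hce ⊢
    have h1 : AEStronglyMeasurable
        (fun p => timeDeriv ψ p + inner ℝ (spaceGrad ψ p) (v p)) (Q.map Φ) :=
      hψ.continuous_timeDeriv.aestronglyMeasurable.add
        (hψ.continuous_spaceGrad.aestronglyMeasurable.inner hvm.aestronglyMeasurable)
    have hint : Integrable (fun θ => inner ℝ (spaceGrad ψ (Φ θ)) (v (Φ θ))) Q :=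
      hψ.integrable_inner hΦ hvint
    rw [← hmap, integral_map hΦ.aemeasurable h1,
      integral_add (hψ.integrable_timeDeriv hΦ) hint, ← hce ψ hψ,
      integral_add (hψ.integrable_timeDeriv hΦ) (hψ.integrable_inner hΦ hwi)]
    congr 1
    have hg : StronglyMeasurable[.comap Φ inferInstance] fun θ => spaceGrad ψ (Φ θ) :=
      (hψ.continuous_spaceGrad.measurable.comp (comap_measurable Φ)).stronglyMeasurable
    have h2 := condExp_bilin_of_stronglyMeasurable_left (μ := Q) (innerSL ℝ) hg
      (hψ.integrable_inner hΦ hwi) hwi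
    rw [← integral_condExp hΦ.comap_le (f := fun θ => inner ℝ (spaceGrad ψ (Φ θ)) (w θ))]
    refine integral_congr_ae ?_
    filter_upwards [h2] with θ hθ
    refine Eq.trans ?_ hθ.symm
    rw [hv]
    rfl
  · have h1 : kinetic ν a b v = ∫⁻ θ, ‖(v ∘ Φ) θ‖ₑ ^ 2 ∂Q := by
      rw [kinetic, ← hmap, lintegral_map (hvm.measurable.enorm.pow_const 2) hΦ]
      rfl
    have h2 := eLpNorm_condExp_le_eLpNorm (μ := Q) (m := .comap Φ inferInstance) w one_le_two
    rw [h1, ← hv]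
    have h3 : ∀ f : Θ → EuclideanSpace ℝ (Fin d), ∫⁻ θ, ‖f θ‖ₑ ^ 2 ∂Q = eLpNorm f 2 Q ^ 2 := by
      intro f
      rw [eLpNorm_eq_lintegral_rpow_enorm_toReal two_ne_zero ENNReal.ofNat_ne_top,
        ← ENNReal.rpow_natCast, ← ENNReal.rpow_mul]
      simp
    rw [h3, h3]
    gcongr

end Lift

end

/-! ### Perimeter, traces and Fourier coefficients -/

section

variable {d : ℕ}

open Classical in
/-- The contribution of a point of mass `m` to the perimeter. At `m = 0` it is set to zero by hand,
because `0 ^ 0 = 1` in dimension one. -/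
def atomCost (d : ℕ) (m : ℝ≥0∞) : ℝ≥0∞ :=
  if m = 0 then 0 else m ^ (((d : ℝ) - 1) / (d : ℝ))

lemma slicePerimeter_eq_tsum (ν : Measure (UnitAddTorus (Fin d))) :
    slicePerimeter ν = ∑' x, atomCost d (ν {x}) := by
  have h : (fun x => atomCost d (ν {x})) = Set.indicator {x | ν {x} ≠ 0}
      fun x => (ν {x}) ^ (((d : ℝ) - 1) / (d : ℝ)) := by
    funext x
    by_cases hx : ν {x} = 0 <;> simp [atomCost, hx]
  rw [h, ← tsum_subtype]
  rfl

lemma exponent_mem (hd : 1 ≤ d) : 0 ≤ ((d : ℝ) - 1) / d ∧ ((d : ℝ) - 1) / d ≤ 1 := by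
  have h : (1 : ℝ) ≤ d := by exact_mod_cast hd
  exact ⟨div_nonneg (by linarith) (by linarith), (div_le_one (by linarith)).2 (by linarith)⟩

lemma atomCost_add_le (hd : 1 ≤ d) (m n : ℝ≥0∞) :
    atomCost d (m + n) ≤ atomCost d m + atomCost d n := by
  by_cases hm : m = 0
  · simp [hm]
  by_cases hn : n = 0
  · simp [hn]
  simpa [atomCost, hm, hn] using
    ENNReal.rpow_add_le_add_rpow m n (exponent_mem hd).1 (exponent_mem hd).2

lemma atomCost_mono (hd : 1 ≤ d) {m n : ℝ≥0∞} (h : m ≤ n) : atomCost d m ≤ atomCost d n := by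
  by_cases hm : m = 0
  · simp [atomCost, hm]
  have hn : n ≠ 0 := fun hn => hm (le_antisymm (hn ▸ h) bot_le)
  simpa [atomCost, hm, hn] using ENNReal.rpow_le_rpow h (exponent_mem hd).1

lemma slicePerimeter_add_le (hd : 1 ≤ d) (ν ρ : Measure (UnitAddTorus (Fin d))) :
    slicePerimeter (ν + ρ) ≤ slicePerimeter ν + slicePerimeter ρ := by
  simp only [slicePerimeter_eq_tsum, ← ENNReal.tsum_add]
  exact ENNReal.tsum_le_tsum fun x => atomCost_add_le hd _ _

lemma slicePerimeter_mono (hd : 1 ≤ d) {ν ρ : Measure (UnitAddTorus (Fin d))} (h : ν ≤ ρ) :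
    slicePerimeter ν ≤ slicePerimeter ρ := by
  simp only [slicePerimeter_eq_tsum]
  exact ENNReal.tsum_le_tsum fun x => atomCost_mono hd (h _)

lemma slicePerimeter_map_add (ν : Measure (UnitAddTorus (Fin d))) (z : UnitAddTorus (Fin d)) :
    slicePerimeter (ν.map (· + z)) = slicePerimeter ν := by
  simp only [slicePerimeter_eq_tsum]
  rw [← (Equiv.addRight z).tsum_eq]
  refine tsum_congr fun x => ?_
  rw [Measure.map_apply (measurable_add_const z) (measurableSet_singleton _)]
  congr 2
  ext y
  simp

/-- If all atoms have mass at least `q`, then a measure of mass at most one has at most `q⁻¹` atoms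
and perimeter at most `q ^ (-1/d)`. -/
lemma slicePerimeter_le_of_le_atoms (hd : 1 ≤ d) (ν : Measure (UnitAddTorus (Fin d)))
    (hν : ν Set.univ ≤ 1) {q : ℝ≥0∞} (hq : ∀ x, ν {x} ≠ 0 → q ≤ ν {x}) :
    slicePerimeter ν ≤ q ^ (-(1 / (d : ℝ))) := by
  have hd' : (0 : ℝ) < d := by exact_mod_cast hd
  have h1 : ∀ x, atomCost d (ν {x}) ≤ q ^ (-(1 / (d : ℝ))) * ν {x} := by
    intro x
    by_cases hx : ν {x} = 0
    · simp [atomCost, hx]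
    have htop : ν {x} ≠ ⊤ := ((measure_mono (Set.subset_univ _)).trans hν).trans_lt
      ENNReal.one_lt_top |>.ne
    have h2 : atomCost d (ν {x}) = (ν {x}) ^ (-(1 / (d : ℝ))) * ν {x} := by
      rw [atomCost, if_neg hx]
      nth_rewrite 3 [← ENNReal.rpow_one (ν {x})]
      rw [← ENNReal.rpow_add _ _ hx htop]
      congr 1
      field_simp
      ring
    rw [h2]
    refine mul_le_mul_left ?_ _
    rw [ENNReal.rpow_neg, ENNReal.rpow_neg]
    exact ENNReal.inv_le_inv.2 (ENNReal.rpow_le_rpow (hq x hx) (by positivity))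
  calc slicePerimeter ν = ∑' x, atomCost d (ν {x}) := slicePerimeter_eq_tsum ν
    _ ≤ ∑' x, q ^ (-(1 / (d : ℝ))) * ν {x} := ENNReal.tsum_le_tsum h1
    _ = q ^ (-(1 / (d : ℝ))) * ∑' x, ν {x} := ENNReal.tsum_mul_left
    _ ≤ q ^ (-(1 / (d : ℝ))) * 1 := by
        gcongr
        refine (tsum_meas_le_meas_iUnion_of_disjoint ν (fun x => measurableSet_singleton x)
          (fun x y hxy => by simpa using hxy)).trans ((measure_mono (Set.subset_univ _)).trans hν)
    _ = _ := mul_one _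

lemma neBot_nhdsGT_inf_ae (t : ℝ) : (𝓝[>] t ⊓ ae (volume : Measure ℝ)).NeBot := by
  rw [Filter.inf_neBot_iff]
  intro s hs s' hs'
  obtain ⟨u, hu, hsub⟩ := mem_nhdsGT_iff_exists_Ioo_subset.1 hs
  by_contra hne
  have h1 : Set.Ioo t u ⊆ s'ᶜ := fun x hx hx' => hne ⟨x, hsub hx, hx'⟩
  have h2 := measure_mono_null h1 (mem_ae_iff.1 hs')
  simp only [Real.volume_Ioo, ENNReal.ofReal_eq_zero, sub_nonpos] at h2
  exact absurd hu (not_lt.2 h2)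

lemma neBot_nhdsLT_inf_ae (t : ℝ) : (𝓝[<] t ⊓ ae (volume : Measure ℝ)).NeBot := by
  rw [Filter.inf_neBot_iff]
  intro s hs s' hs'
  obtain ⟨u, hu, hsub⟩ := mem_nhdsLT_iff_exists_Ioo_subset.1 hs
  by_contra hne
  have h1 : Set.Ioo u t ⊆ s'ᶜ := fun x hx hx' => hne ⟨x, hsub hx, hx'⟩
  have h2 := measure_mono_null h1 (mem_ae_iff.1 hs')
  simp only [Real.volume_Ioo, ENNReal.ofReal_eq_zero, sub_nonpos] at h2
  exact absurd hu (not_lt.2 h2)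

lemma IsTrace.unique {μ : Kernel ℝ (UnitAddTorus (Fin d))} {l : Filter ℝ}
    (hl : (l ⊓ ae (volume : Measure ℝ)).NeBot) {ρ ρ' : Measure (UnitAddTorus (Fin d))}
    (h : IsTrace μ l ρ) (h' : IsTrace μ l ρ') : ρ = ρ' := by
  have := h.1
  have := h'.1
  refine ext_of_forall_integral_eq_of_IsFiniteMeasure fun f => ?_
  exact tendsto_nhds_unique (h.2 f.toContinuousMap) (h'.2 f.toContinuousMap)

lemma IsTrace.trace_eq {μ : Kernel ℝ (UnitAddTorus (Fin d))} {l : Filter ℝ}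
    (hl : (l ⊓ ae (volume : Measure ℝ)).NeBot) {ρ : Measure (UnitAddTorus (Fin d))}
    (h : IsTrace μ l ρ) : trace μ l = ρ := by
  have hex : ∃ ρ, IsTrace μ l ρ := ⟨ρ, h⟩
  rw [trace, dif_pos hex]
  exact hex.choose_spec.unique hl h

lemma trace_congr {μ ν : Kernel ℝ (UnitAddTorus (Fin d))} {l : Filter ℝ}
    (h : ∀ᶠ t in l, μ t = ν t) : trace μ l = trace ν l := by
  have h2 : IsTrace μ l = IsTrace ν l := by
    funext ρ
    refine propext (and_congr_right fun _ => forall_congr' fun f => tendsto_congr' ?_)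
    filter_upwards [h.filter_mono inf_le_left] with t ht
    rw [ht]
  unfold trace
  rw [h2]

lemma mFourier_torusMk (k : Fin d → ℤ) (y : Fin d → ℝ) :
    UnitAddTorus.mFourier k (torusMk y) =
      Complex.exp (2 * Real.pi * Complex.I * ((∑ i, k i * y i : ℝ) : ℂ)) := by
  simp only [UnitAddTorus.mFourier, torusMk, ContinuousMap.coe_mk, fourier_coe_apply]
  rw [← Complex.exp_sum]
  congr 1
  push_cast
  rw [Finset.mul_sum]
  refine Finset.sum_congr rfl fun i _ => ?_
  ring

lemma mFourier_add_arg (k : Fin d → ℤ) (x y : UnitAddTorus (Fin d)) :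
    UnitAddTorus.mFourier k (x + y) = UnitAddTorus.mFourier k x * UnitAddTorus.mFourier k y := by
  simp only [UnitAddTorus.mFourier, ContinuousMap.coe_mk, Pi.add_apply, ← Finset.prod_mul_distrib]
  refine Finset.prod_congr rfl fun i _ => ?_
  simp [fourier_apply, smul_add, AddCircle.toCircle_add]

lemma integral_mFourier_of_ne {k : Fin d → ℤ} (hk : k ≠ 0) :
    ∫ x, UnitAddTorus.mFourier k x ∂(volume : Measure (UnitAddTorus (Fin d))) = 0 := by
  obtain ⟨j, hj⟩ := Function.ne_iff.1 hk
  -- a translation by half a period in direction `j` changes the sign of the integral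
  have hj' : ((k j : ℤ) : ℝ) ≠ 0 := by exact_mod_cast hj
  have h1 : UnitAddTorus.mFourier k (torusMk (Pi.single j (1 / (2 * (k j : ℝ))))) = -1 := by
    rw [mFourier_torusMk]
    have : (∑ i, (k i : ℝ) * (Pi.single j (1 / (2 * (k j : ℝ))) : Fin d → ℝ) i) = 1 / 2 := by
      simp only [Pi.single_apply, mul_ite, mul_zero, Finset.sum_ite_eq', Finset.mem_univ, if_true]
      field_simp
    rw [this, ← Complex.exp_pi_mul_I]
    congr 1
    push_cast
    ring
  have h2 := integral_add_right_eq_self (μ := (volume : Measure (UnitAddTorus (Fin d))))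
    (fun x => UnitAddTorus.mFourier k x) (torusMk (Pi.single j (1 / (2 * (k j : ℝ)))))
  simp only [mFourier_add_arg, h1, integral_mul_const] at h2
  linear_combination (-1 / 2) * h2

instance isProbabilityMeasure_unitAddCircle :
    IsProbabilityMeasure (volume : Measure UnitAddCircle) :=
  ⟨UnitAddCircle.measure_univ⟩

lemma deviationSq_volume (r : ℝ) :
    deviationSq r (volume : Measure (UnitAddTorus (Fin d))) = 0 := by
  simp [deviationSq]

/-- The Fourier coefficient of `ρ - 1` at the frequency `k`. -/
def devCoeff (ρ : Measure (UnitAddTorus (Fin d))) (k : Fin d → ℤ) : ℂ :=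
  (∫ x, UnitAddTorus.mFourier k x ∂ρ) -
    ∫ x, UnitAddTorus.mFourier k x ∂(volume : Measure (UnitAddTorus (Fin d)))

lemma devCoeff_of_ne (ρ : Measure (UnitAddTorus (Fin d))) {k : Fin d → ℤ} (hk : k ≠ 0) :
    devCoeff ρ k = ∫ x, UnitAddTorus.mFourier k x ∂ρ := by
  rw [devCoeff, integral_mFourier_of_ne hk, sub_zero]

lemma deviationSq_eq (r : ℝ) (ρ : Measure (UnitAddTorus (Fin d))) :
    deviationSq r ρ = ∑' k, freqNorm k ^ (-2 * r) * ‖devCoeff ρ k‖ₑ ^ 2 := rfl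

/-- The weight of the zero frequency is infinite, so a finite deviation forces mass one. -/
lemma devCoeff_zero_of_deviationSq {r : ℝ} (hr : 0 < r) {ρ : Measure (UnitAddTorus (Fin d))}
    (h : deviationSq r ρ ≠ ⊤) : devCoeff ρ 0 = 0 := by
  have h0 := ENNReal.ne_top_of_tsum_ne_top h 0
  have hz : (freqNorm (0 : Fin d → ℤ)) ^ (-2 * r) = ⊤ := by
    simp [freqNorm, hr]
  rw [hz] at h0
  by_contra hne
  refine h0 (ENNReal.top_mul ?_)
  exact pow_ne_zero 2 (enorm_ne_zero.2 hne)

lemma isTrace_trace_of_deviationSq {r : ℝ} (hr : 0 < r) {μ : Kernel ℝ (UnitAddTorus (Fin d))}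
    {l : Filter ℝ} (h : deviationSq r (trace μ l) ≠ ⊤) : IsTrace μ l (trace μ l) := by
  by_cases hex : ∃ ρ, IsTrace μ l ρ
  · rw [trace, dif_pos hex]
    exact hex.choose_spec
  · have h0 : trace μ l = 0 := by rw [trace, dif_neg hex]
    have h1 := devCoeff_zero_of_deviationSq hr h
    rw [h0] at h1
    simp [devCoeff, UnitAddTorus.mFourier_zero] at h1

end

/-! ### Splitting a measure into two translates -/

section

variable {d : ℕ} {a b : ℝ}

lemma measurable_add_torusMk {g : ℝ → Fin d → ℝ} (hg : Continuous g) :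
    Measurable fun p : ℝ × UnitAddTorus (Fin d) => p.2 + torusMk (g p.1) :=
  ((shear hg).continuous.snd).measurable

/-- The average of the two translates of `μ_t` by `g t` and by `-g t`, so that the total mass is
preserved. -/
def splitKernel (μ : Kernel ℝ (UnitAddTorus (Fin d))) [IsFiniteKernel μ] (g : ℝ → Fin d → ℝ)
    (hg : Continuous g) : Kernel ℝ (UnitAddTorus (Fin d)) where
  toFun t := (1 / 2 : ℝ≥0∞) •
    ((μ t).map (· + torusMk (g t)) + (μ t).map (· + torusMk (-g t)))
  measurable' := by
    refine Measure.measurable_of_measurable_coe _ fun s hs => ?_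
    have h : ∀ g : ℝ → Fin d → ℝ, Continuous g →
        Measurable fun t => (μ t).map (· + torusMk (g t)) s := by
      intro g hg
      have := Kernel.measurable_kernel_prodMk_left (κ := μ) ((measurable_add_torusMk hg) hs)
      have heq : (fun t => (μ t).map (· + torusMk (g t)) s) =
          fun t => μ t (Prod.mk t ⁻¹' ((fun p => p.2 + torusMk (g p.1)) ⁻¹' s)) :=
        funext fun t => by
          rw [Measure.map_apply (measurable_add_const _) hs]
          rfl
      rw [heq]
      exact this
    simp only [Measure.smul_apply, Measure.add_apply, smul_eq_mul]
    exact ((h g hg).add (h (fun t => -g t) hg.neg)).const_mul _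

section Split

variable {μ : Kernel ℝ (UnitAddTorus (Fin d))} [IsFiniteKernel μ] {g : ℝ → Fin d → ℝ}
  {hg : Continuous g}

lemma splitKernel_apply (t : ℝ) : splitKernel μ g hg t = (1 / 2 : ℝ≥0∞) •
    ((μ t).map (· + torusMk (g t)) + (μ t).map (· + torusMk (-g t))) := rfl

lemma half_add_self (x : ℝ≥0∞) : (1 / 2 : ℝ≥0∞) * (x + x) = x := by
  rw [← two_mul, ← mul_assoc, one_div, ENNReal.inv_mul_cancel two_ne_zero ENNReal.ofNat_ne_top,
    one_mul]

lemma splitKernel_apply_of_eq_zero {t : ℝ} (ht : g t = 0) : splitKernel μ g hg t = μ t := by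
  have h0 : torusMk (0 : Fin d → ℝ) = 0 := by ext i; simp [torusMk]
  ext s hs
  simp only [splitKernel_apply, ht, h0, neg_zero, add_zero, Measure.map_id', Measure.smul_apply,
    Measure.add_apply, smul_eq_mul, half_add_self]

instance isFiniteKernel_splitKernel : IsFiniteKernel (splitKernel μ g hg) := by
  refine ⟨⟨μ.bound, μ.bound_lt_top, fun t => ?_⟩⟩
  simp only [splitKernel_apply, Measure.smul_apply, Measure.add_apply, smul_eq_mul,
    Measure.map_apply (measurable_add_const _) MeasurableSet.univ, Set.preimage_univ, half_add_self]
  exact μ.measure_le_bound t _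

lemma isAtomic_splitKernel {t : ℝ} (h : IsAtomic (μ t)) : IsAtomic (splitKernel μ g hg t) := by
  obtain ⟨S, hS, h0⟩ := h
  refine ⟨(fun x => x + torusMk (g t)) '' S ∪ (fun x => x + torusMk (-g t)) '' S,
    (hS.image _).union (hS.image _), ?_⟩
  have hm : MeasurableSet ((fun x => x + torusMk (g t)) '' S ∪
      (fun x => x + torusMk (-g t)) '' S)ᶜ :=
    ((hS.image _).union (hS.image _)).measurableSet.compl
  simp only [splitKernel_apply, Measure.smul_apply, Measure.add_apply, smul_eq_mul,
    Measure.map_apply (measurable_add_const _) hm]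
  rw [measure_mono_null _ h0, measure_mono_null _ h0]
  · simp
  · intro x hx hxS
    exact hx (Or.inr ⟨x, hxS, rfl⟩)
  · intro x hx hxS
    exact hx (Or.inl ⟨x, hxS, rfl⟩)

lemma slicePerimeter_splitKernel_le (hd : 1 ≤ d) (t : ℝ) :
    slicePerimeter (splitKernel μ g hg t) ≤ 2 * slicePerimeter (μ t) := by
  have h1 : splitKernel μ g hg t ≤ (μ t).map (· + torusMk (g t)) +
      (μ t).map (· + torusMk (-g t)) := by
    intro s
    rw [splitKernel_apply, Measure.smul_apply, smul_eq_mul]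
    exact mul_le_of_le_one_left' (ENNReal.half_le_self.trans_eq rfl)
  refine (slicePerimeter_mono hd h1).trans ((slicePerimeter_add_le hd _ _).trans ?_)
  rw [slicePerimeter_map_add, slicePerimeter_map_add, two_mul]

lemma integral_splitKernel {E : Type*} [NormedAddCommGroup E] [NormedSpace ℝ E] (t : ℝ)
    (f : C(UnitAddTorus (Fin d), E)) :
    ∫ x, f x ∂(splitKernel μ g hg t) = (1 / 2 : ℝ) •
      (∫ x, f (x + torusMk (g t)) ∂(μ t) + ∫ x, f (x + torusMk (-g t)) ∂(μ t)) := by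
  have h : ∀ z, Integrable f ((μ t).map (· + z)) := fun z =>
    f.continuous.integrable_of_hasCompactSupport (HasCompactSupport.of_compactSpace f)
  have h2 : ∀ z, ∫ x, f x ∂((μ t).map (· + z)) = ∫ x, f (x + z) ∂(μ t) := fun z =>
    (Homeomorph.addRight z).measurableEmbedding.integral_map f
  rw [splitKernel_apply, integral_smul_measure, integral_add_measure (h _) (h _), h2, h2]
  simp

/-- The law of a random sign. -/
def coin : Measure ℝ := (1 / 2 : ℝ≥0∞) • (Measure.dirac 1 + Measure.dirac (-1))

instance : IsFiniteMeasure coin := by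
  refine ⟨?_⟩
  simp [coin]

lemma lintegral_coin (f : ℝ → ℝ≥0∞) : ∫⁻ σ, f σ ∂coin = (1 / 2) * (f 1 + f (-1)) := by
  simp [coin, lintegral_smul_measure, lintegral_add_measure, mul_add]

lemma integral_coin (f : ℝ → ℝ) : ∫ σ, f σ ∂coin = (1 / 2) * (f 1 + f (-1)) := by
  rw [coin, integral_smul_measure, integral_add_measure
    (integrable_dirac (by simp)) (integrable_dirac (by simp))]
  simp

/-- The position at time `t` of a particle at `x`, displaced by `σ g(t)`. -/
def splitMap (g : ℝ → Fin d → ℝ) (θ : (ℝ × UnitAddTorus (Fin d)) × ℝ) :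
    ℝ × UnitAddTorus (Fin d) :=
  (θ.1.1, θ.1.2 + torusMk (θ.2 • g θ.1.1))

lemma measurable_splitMap (hg : Continuous g) : Measurable (splitMap g) := by
  have := continuous_torusMk (d := d)
  have h : Continuous (splitMap g) := by unfold splitMap; fun_prop
  exact h.measurable

lemma map_splitMap :
    ((spaceTime μ a b).prod coin).map (splitMap g) = spaceTime (splitKernel μ g hg) a b := by
  refine Measure.ext_of_lintegral _ fun f hf => ?_
  have hm1 : Measurable fun p : ℝ × UnitAddTorus (Fin d) => f (splitMap g (p, 1)) :=
    hf.comp ((measurable_splitMap hg).comp measurable_prodMk_right)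
  have hm2 : Measurable fun p : ℝ × UnitAddTorus (Fin d) => f (splitMap g (p, -1)) :=
    hf.comp ((measurable_splitMap hg).comp measurable_prodMk_right)
  rw [lintegral_map hf (measurable_splitMap hg),
    lintegral_prod (fun θ => f (splitMap g θ)) (hf.comp (measurable_splitMap hg)).aemeasurable]
  have hm : Measurable fun p : ℝ × UnitAddTorus (Fin d) =>
      (1 / 2 : ℝ≥0∞) * (f (splitMap g (p, 1)) + f (splitMap g (p, -1))) := (hm1.add hm2).const_mul _
  have hm1' : ∀ t, Measurable fun x => f (splitMap g ((t, x), 1)) :=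
    fun t => hm1.comp measurable_prodMk_left
  have hm2' : ∀ t, Measurable fun x => f (splitMap g ((t, x), -1)) :=
    fun t => hm2.comp measurable_prodMk_left
  simp only [lintegral_coin]
  rw [spaceTime, spaceTime, Measure.lintegral_compProd hm,
    Measure.lintegral_compProd hf]
  refine lintegral_congr fun t => ?_
  have hft : Measurable fun x => f (t, x) := hf.comp measurable_prodMk_left
  rw [lintegral_const_mul' _ _ (by simp), lintegral_add_left (hm1' t),
    splitKernel_apply,
    lintegral_smul_measure, lintegral_add_measure,
    lintegral_map hft (measurable_add_const _),
    lintegral_map hft (measurable_add_const _)]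
  simp [splitMap]

/-- Splitting `μ` along `±g` costs at most the kinetic energy of `g`: the mixed terms cancel, by the
parallelogram identity. -/
theorem exists_isVelocity_splitKernel (hgs : ContDiff ℝ ∞ g)
    (hfin : ∫⁻ p, ‖(WithLp.toLp 2 (deriv g p.1) : EuclideanSpace ℝ (Fin d))‖ₑ ^ 2
      ∂(spaceTime μ a b) ≠ ⊤)
    {v : ℝ × UnitAddTorus (Fin d) → EuclideanSpace ℝ (Fin d)} (hv : IsVelocity μ a b v)
    (hkin : kinetic μ a b v ≠ ⊤) :
    ∃ v', IsVelocity (splitKernel μ g hg) a b v' ∧ kinetic (splitKernel μ g hg) a b v' ≤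
      kinetic μ a b v + ∫⁻ p, ‖(WithLp.toLp 2 (deriv g p.1) : EuclideanSpace ℝ (Fin d))‖ₑ ^ 2
        ∂(spaceTime μ a b) := by
  set G : ℝ × UnitAddTorus (Fin d) → EuclideanSpace ℝ (Fin d) :=
    fun p => WithLp.toLp 2 (deriv g p.1) with hG
  have hGc : Continuous G :=
    (PiLp.continuous_toLp 2 _).comp ((hgs.continuous_deriv (by simp)).comp continuous_fst)
  have hL2 : ∀ f : ℝ × UnitAddTorus (Fin d) → EuclideanSpace ℝ (Fin d),
      AEStronglyMeasurable f (spaceTime μ a b) → ∫⁻ p, ‖f p‖ₑ ^ 2 ∂(spaceTime μ a b) ≠ ⊤ →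
      MemLp f 2 (spaceTime μ a b) := by
    intro f hf hfin
    refine ⟨hf, ?_⟩
    rw [eLpNorm_lt_top_iff_lintegral_rpow_enorm_lt_top two_ne_zero ENNReal.ofNat_ne_top]
    simpa using hfin.lt_top
  have hv2 := hL2 v hv.integrable.1 hkin
  have hG2 := hL2 G hGc.aestronglyMeasurable hfin
  set Q := (spaceTime μ a b).prod coin with hQ
  let w : (ℝ × UnitAddTorus (Fin d)) × ℝ → EuclideanSpace ℝ (Fin d) :=
    fun θ => v θ.1 + θ.2 • G θ.1
  have hfst : ∀ {f : ℝ × UnitAddTorus (Fin d) → EuclideanSpace ℝ (Fin d)},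
      MemLp f 2 (spaceTime μ a b) → MemLp (fun θ : (ℝ × UnitAddTorus (Fin d)) × ℝ => f θ.1) 2 Q :=
    fun hf => hf.comp_fst coin
  have hsign : ∀ᵐ θ ∂Q, ‖θ.2‖ ≤ 1 := by
    refine Measure.quasiMeasurePreserving_snd.ae (p := fun σ : ℝ => ‖σ‖ ≤ 1) ?_
    refine Measure.ae_smul_measure ?_ _
    rw [ae_add_measure_iff]
    simp [ae_dirac_eq]
  have hw2 : MemLp w 2 Q := by
    refine (hfst hv2).add ?_
    refine (hfst hG2).of_le ?_ ?_
    · exact (measurable_snd.aestronglyMeasurable).smul (hfst hG2).1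
    · filter_upwards [hsign] with θ hθ
      rw [norm_smul]
      exact mul_le_of_le_one_left (norm_nonneg _) hθ
  have hmeas := measurable_splitMap hg
  -- for each sign `σ`, the displaced test function is an admissible test function for `μ`
  have hce : ∀ ψ, IsTest a b ψ → ∫ θ, (timeDeriv ψ (splitMap g θ) +
      ∑ j, spaceDeriv ψ j (splitMap g θ) * w θ j) ∂Q = 0 := by
    intro ψ hψ
    have hwi := hw2.integrable one_le_two
    have hint : Integrable (fun θ => timeDeriv ψ (splitMap g θ) +
        ∑ j, spaceDeriv ψ j (splitMap g θ) * w θ j) Q := by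
      simp only [← inner_spaceGrad]
      exact (hψ.integrable_timeDeriv hmeas).add (hψ.integrable_inner hmeas hwi)
    rw [integral_prod _ hint]
    simp only [integral_coin]
    have key : ∀ σ : ℝ, Integrable (fun p => timeDeriv ψ (splitMap g (p, σ)) +
        ∑ j, spaceDeriv ψ j (splitMap g (p, σ)) * w (p, σ) j) (spaceTime μ a b) ∧
        ∫ p, (timeDeriv ψ (splitMap g (p, σ)) +
        ∑ j, spaceDeriv ψ j (splitMap g (p, σ)) * w (p, σ) j) ∂(spaceTime μ a b) = 0 := by
      intro σ
      have hsm : Measurable fun p => splitMap g (p, σ) := hmeas.comp measurable_prodMk_right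
      constructor
      · simp only [← inner_spaceGrad]
        exact (hψ.integrable_timeDeriv hsm).add (hψ.integrable_inner hsm
          ((hv2.add (hG2.const_smul σ)).integrable one_le_two))
      · rw [← hv.continuity_eq _ (hψ.comp_shear (hgs.const_smul σ))]
        refine integral_congr_ae (ae_of_all _ fun p => ?_)
        have hd1 : HasDerivAt (fun t => σ • g t) (σ • deriv g p.1) p.1 :=
          ((hgs.differentiable (by simp)) p.1).hasDerivAt.const_smul σ
        simp only [hψ.timeDeriv_comp_shear hd1,
          spaceDeriv_comp_shear (ψ := ψ) (fun t => σ • g t), splitMap, w, hG]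
        rw [add_assoc, ← Finset.sum_add_distrib]
        congr 1
        refine Finset.sum_congr rfl fun j _ => ?_
        simp
        ring
    rw [integral_const_mul, integral_add (key 1).1 (key (-1)).1, (key 1).2, (key (-1)).2]
    simp
  obtain ⟨v', hv', hk⟩ := exists_isVelocity_of_lift (ν := splitKernel μ g hg) (a := a) (b := b)
    hmeas map_splitMap hw2 hce
  refine ⟨v', hv', hk.trans ?_⟩
  have haem : AEMeasurable (fun θ => ‖w θ‖ₑ ^ 2) Q := (hw2.1.enorm.pow_const 2)
  rw [lintegral_prod _ haem]
  simp only [lintegral_coin, w]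
  rw [kinetic, ← lintegral_add_left' (hv.integrable.1.enorm.pow_const 2)]
  refine lintegral_mono fun p => le_of_eq ?_
  have hpar := parallelogram_law_with_norm ℝ (v p) (G p)
  have hen : ∀ u : EuclideanSpace ℝ (Fin d), ‖u‖ₑ ^ 2 = ENNReal.ofReal (‖u‖ ^ 2) := fun u => by
    rw [ENNReal.ofReal_pow (norm_nonneg _), ofReal_norm]
  have h2 : (1 / 2 : ℝ≥0∞) = ENNReal.ofReal (1 / 2) := by
    rw [ENNReal.ofReal_div_of_pos two_pos]; simp
  simp only [one_smul, neg_smul, hen, h2]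
  rw [← ENNReal.ofReal_add (by positivity) (by positivity),
    ← ENNReal.ofReal_add (by positivity) (by positivity), ← ENNReal.ofReal_mul (by positivity)]
  congr 1
  rw [← sub_eq_add_neg]
  linarith

end Split

end

/-! ### Dyadic branching on the line -/

section

lemma deriv_smoothTransition_of_nonpos {x : ℝ} (hx : x ≤ 0) :
    deriv Real.smoothTransition x = 0 := by
  have h : IsLocalMin Real.smoothTransition x := Filter.Eventually.of_forall fun y => by
    rw [Real.smoothTransition.zero_of_nonpos hx]
    exact Real.smoothTransition.nonneg y
  exact h.deriv_eq_zero

lemma deriv_smoothTransition_of_one_le {x : ℝ} (hx : 1 ≤ x) :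
    deriv Real.smoothTransition x = 0 := by
  have h : IsLocalMax Real.smoothTransition x := Filter.Eventually.of_forall fun y => by
    rw [Real.smoothTransition.one_of_one_le hx]
    exact Real.smoothTransition.le_one y
  exact h.deriv_eq_zero

lemma contDiff_smoothTransition : ContDiff ℝ ∞ Real.smoothTransition :=
  Real.smoothTransition.contDiff

lemma exists_bound_deriv_smoothTransition :
    ∃ C, 0 ≤ C ∧ ∀ x, |deriv Real.smoothTransition x| ≤ C := by
  have hc : Continuous (deriv Real.smoothTransition) :=
    contDiff_smoothTransition.continuous_deriv (by simp)
  obtain ⟨C, hC⟩ := (HasCompactSupport.intro (K := Set.Icc 0 1) isCompact_Icc fun x hx => by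
    rw [Set.mem_Icc, not_and_or, not_le, not_le] at hx
    rcases hx with hx | hx
    · exact deriv_smoothTransition_of_nonpos hx.le
    · exact deriv_smoothTransition_of_one_le hx.le).exists_bound_of_continuous hc
  exact ⟨C, (abs_nonneg _).trans (hC 0), hC⟩

/-- The left end point of the dyadic interval of length `2⁻ʲ`, closed on the right, that
contains `r`. -/
def dyadic (j : ℕ) (r : ℝ) : ℝ := (⌈(2 : ℝ) ^ j * r⌉ - 1) / 2 ^ j

/-- The displacement of the `j`-th branching. -/
def dyadicIncr (j : ℕ) (r : ℝ) : ℝ := dyadic (j + 1) r - dyadic j r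

lemma dyadic_lt (j : ℕ) (r : ℝ) : dyadic j r < r := by
  rw [dyadic, div_lt_iff₀ (by positivity)]
  linarith [Int.ceil_lt_add_one ((2 : ℝ) ^ j * r)]

lemma sub_le_dyadic (j : ℕ) (r : ℝ) : r - (1 / 2) ^ j ≤ dyadic j r := by
  have h : (1 / 2 : ℝ) ^ j = 1 / 2 ^ j := by rw [div_pow, one_pow]
  rw [dyadic, h, le_div_iff₀ (by positivity), sub_mul, one_div,
    inv_mul_cancel₀ (by positivity)]
  linarith [Int.le_ceil ((2 : ℝ) ^ j * r)]

lemma abs_dyadicIncr_le (j : ℕ) (r : ℝ) : |dyadicIncr j r| ≤ (1 / 2) ^ j := by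
  have h1 := dyadic_lt j r
  have h2 := sub_le_dyadic j r
  have h3 := dyadic_lt (j + 1) r
  have h4 := sub_le_dyadic (j + 1) r
  have h5 : (1 / 2 : ℝ) ^ (j + 1) ≤ (1 / 2) ^ j := by
    rw [pow_succ]; nlinarith [pow_pos (one_half_pos (α := ℝ)) j]
  rw [dyadicIncr, abs_le]
  constructor <;> linarith

lemma measurable_dyadicIncr (j : ℕ) : Measurable (dyadicIncr j) := by
  unfold dyadicIncr dyadic
  fun_prop

lemma dyadic_zero {r : ℝ} (hr : r ∈ Set.Ioc (0 : ℝ) 1) : dyadic 0 r = 0 := by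
  have : ⌈r⌉ = 1 := by
    rw [Int.ceil_eq_iff]; simpa using hr
  simp [dyadic, this]

lemma tendsto_dyadic (r : ℝ) : Tendsto (fun j => dyadic j r) atTop (𝓝 r) := by
  have h : Tendsto (fun j : ℕ => r - (1 / 2 : ℝ) ^ j) atTop (𝓝 r) := by
    simpa using (tendsto_pow_atTop_nhds_zero_of_lt_one (r := (1 / 2 : ℝ))
      (by norm_num) (by norm_num)).const_sub r
  exact tendsto_of_tendsto_of_tendsto_of_le_of_le h tendsto_const_nhds
    (fun j => sub_le_dyadic j r) (fun j => (dyadic_lt j r).le)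

/-- Points in the same dyadic interval of generation `N` are in the same interval of each earlier
generation. -/
lemma ceil_eq_of_le {N j : ℕ} (hj : j ≤ N) {r r' : ℝ}
    (h : ⌈(2 : ℝ) ^ N * r⌉ = ⌈(2 : ℝ) ^ N * r'⌉) : ⌈(2 : ℝ) ^ j * r⌉ = ⌈(2 : ℝ) ^ j * r'⌉ := by
  have key : ∀ (s : ℝ) (z : ℤ), ⌈(2 : ℝ) ^ j * s⌉ ≤ z ↔ ⌈(2 : ℝ) ^ N * s⌉ ≤ 2 ^ (N - j) * z := by
    intro s z
    rw [Int.ceil_le, Int.ceil_le]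
    push_cast
    have h2 : (2 : ℝ) ^ N = 2 ^ (N - j) * 2 ^ j := by rw [← pow_add, Nat.sub_add_cancel hj]
    rw [h2, mul_assoc, mul_le_mul_iff_right₀ (by positivity)]
  refine eq_of_forall_ge_iff fun z => ?_
  rw [key, key, h]

/-- The squared time at which the `j`-th branching starts. The factor `1/3` lies between `1/4` and
`1/2`, so that both the kinetic energy and the perimeter of the branching tree are finite. -/
def branchTime (T : ℝ) (j : ℕ) : ℝ := T ^ 2 * (1 - (1 / 3) ^ j)

/-- The progress of the `j`-th branching at time `t`. -/
def branchRamp (T : ℝ) (j : ℕ) (t : ℝ) : ℝ :=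
  Real.smoothTransition ((t ^ 2 - branchTime T j) / (branchTime T (j + 1) - branchTime T j))

variable {T : ℝ}

lemma branchTime_sub (T : ℝ) (j : ℕ) :
    branchTime T (j + 1) - branchTime T j = 2 / 3 * T ^ 2 * (1 / 3) ^ j := by
  unfold branchTime; ring

lemma branchTime_sub_pos (hT : 0 < T) (j : ℕ) : 0 < branchTime T (j + 1) - branchTime T j := by
  rw [branchTime_sub]; positivity

lemma branchTime_mono (hT : 0 < T) : Monotone (branchTime T) :=
  monotone_nat_of_le_succ fun j => by linarith [branchTime_sub_pos hT j]

lemma branchTime_lt (hT : 0 < T) (j : ℕ) : branchTime T j < T ^ 2 := by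
  have : 0 < T ^ 2 * (1 / 3) ^ j := by positivity
  unfold branchTime; linarith

lemma branchTime_zero : branchTime T 0 = 0 := by simp [branchTime]

lemma tendsto_branchTime : Tendsto (branchTime T) atTop (𝓝 (T ^ 2)) := by
  have := ((tendsto_pow_atTop_nhds_zero_of_lt_one (r := (1 / 3 : ℝ))
      (by norm_num) (by norm_num)).const_sub 1).const_mul (T ^ 2)
  simp only [sub_zero, mul_one] at this
  exact this

/-- Each time in `(-T, T)` belongs to exactly one branching period. -/
lemma exists_branchTime {t : ℝ} (ht : t ∈ Set.Ioo (-T) T) :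
    ∃ J, branchTime T J ≤ t ^ 2 ∧ t ^ 2 < branchTime T (J + 1) := by
  have h1 : t ^ 2 < T ^ 2 := sq_lt_sq' ht.1 ht.2
  have hex : ∃ n, t ^ 2 < branchTime T n :=
    ((tendsto_branchTime (T := T)).eventually (lt_mem_nhds h1)).exists
  classical
  have hs := Nat.find_spec hex
  have h0 : Nat.find hex ≠ 0 := by
    intro h0
    rw [h0, branchTime_zero] at hs
    exact absurd hs (not_lt.2 (sq_nonneg t))
  obtain ⟨J, hJ⟩ := Nat.exists_eq_succ_of_ne_zero h0
  refine ⟨J, not_lt.1 (Nat.find_min hex (by omega)), ?_⟩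
  rwa [hJ] at hs

lemma branchRamp_of_le (hT : 0 < T) {j : ℕ} {t : ℝ} (h : t ^ 2 ≤ branchTime T j) :
    branchRamp T j t = 0 :=
  Real.smoothTransition.zero_of_nonpos
    (div_nonpos_of_nonpos_of_nonneg (by linarith) (branchTime_sub_pos hT j).le)

lemma branchRamp_of_ge (hT : 0 < T) {j : ℕ} {t : ℝ} (h : branchTime T (j + 1) ≤ t ^ 2) :
    branchRamp T j t = 1 :=
  Real.smoothTransition.one_of_one_le
    ((one_le_div (branchTime_sub_pos hT j)).2 (by linarith))

lemma abs_branchRamp_le (T : ℝ) (j : ℕ) (t : ℝ) : |branchRamp T j t| ≤ 1 := by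
  rw [branchRamp, abs_of_nonneg (Real.smoothTransition.nonneg _)]
  exact Real.smoothTransition.le_one _

lemma continuous_branchRamp (T : ℝ) (j : ℕ) : Continuous (branchRamp T j) :=
  Real.smoothTransition.continuous.comp (by fun_prop)

lemma hasDerivAt_branchRamp (T : ℝ) (j : ℕ) (t : ℝ) :
    HasDerivAt (branchRamp T j)
      (deriv Real.smoothTransition
        ((t ^ 2 - branchTime T j) / (branchTime T (j + 1) - branchTime T j)) *
        (2 * t / (branchTime T (j + 1) - branchTime T j))) t := by
  have h1 : HasDerivAt
      (fun t : ℝ => (t ^ 2 - branchTime T j) / (branchTime T (j + 1) - branchTime T j))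
      (2 * t / (branchTime T (j + 1) - branchTime T j)) t := by
    simpa using ((hasDerivAt_pow 2 t).sub_const (branchTime T j)).div_const
      (branchTime T (j + 1) - branchTime T j)
  have h2 := ((contDiff_smoothTransition.differentiable (by simp)) ((t ^ 2 - branchTime T j) /
    (branchTime T (j + 1) - branchTime T j))).hasDerivAt
  exact h2.comp t h1

lemma deriv_branchRamp_of_le (hT : 0 < T) {j : ℕ} {t : ℝ} (h : t ^ 2 ≤ branchTime T j) :
    deriv (branchRamp T j) t = 0 := by
  rw [(hasDerivAt_branchRamp T j t).deriv, deriv_smoothTransition_of_nonpos, zero_mul]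
  exact div_nonpos_of_nonpos_of_nonneg (by linarith) (branchTime_sub_pos hT j).le

lemma deriv_branchRamp_of_ge (hT : 0 < T) {j : ℕ} {t : ℝ} (h : branchTime T (j + 1) ≤ t ^ 2) :
    deriv (branchRamp T j) t = 0 := by
  rw [(hasDerivAt_branchRamp T j t).deriv, deriv_smoothTransition_of_one_le, zero_mul]
  exact (one_le_div (branchTime_sub_pos hT j)).2 (by linarith)

lemma exists_bound_deriv_branchRamp (hT : 0 < T) :
    ∃ C, 0 ≤ C ∧ ∀ j, ∀ t ∈ Set.Ioo (-T) T, |deriv (branchRamp T j) t| ≤ C * 3 ^ j := by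
  obtain ⟨C, hC0, hC⟩ := exists_bound_deriv_smoothTransition
  refine ⟨C * (3 / T), by positivity, fun j t ht => ?_⟩
  rw [(hasDerivAt_branchRamp T j t).deriv, abs_mul, mul_assoc]
  refine mul_le_mul (hC _) ?_ (abs_nonneg _) hC0
  have h1 : |t| ≤ T := (abs_lt.2 ht).le
  have h3 : (1 / 3 : ℝ) ^ j = 1 / 3 ^ j := by rw [div_pow, one_pow]
  rw [abs_div, abs_of_pos (branchTime_sub_pos hT j), abs_mul, abs_two, branchTime_sub,
    div_le_iff₀ (by positivity), h3]
  have h4 : 3 / T * 3 ^ j * (2 / 3 * T ^ 2 * (1 / 3 ^ j)) = 2 * T := by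
    field_simp
  rw [h4]; linarith

/-- The position at time `t` of the particle that ends at `r ∈ (0, 1]`: the sum of the
displacements, each weighted with its progress. -/
def branchPath (T t r : ℝ) : ℝ := ∑' j, branchRamp T j t * dyadicIncr j r

/-- The velocity of `branchPath`. -/
def branchSpeed (T t r : ℝ) : ℝ := ∑' j, deriv (branchRamp T j) t * dyadicIncr j r

lemma abs_branchPath_term_le (T t r : ℝ) (j : ℕ) :
    ‖branchRamp T j t * dyadicIncr j r‖ ≤ (1 / 2) ^ j := by
  rw [norm_mul]
  exact (mul_le_of_le_one_left (norm_nonneg _) (abs_branchRamp_le T j t)).trans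
    (abs_dyadicIncr_le j r)

lemma summable_branchPath (T t r : ℝ) : Summable fun j => branchRamp T j t * dyadicIncr j r :=
  Summable.of_norm_bounded (summable_geometric_of_lt_one (by norm_num) (by norm_num))
    (abs_branchPath_term_le T t r)

lemma continuous_branchPath (T r : ℝ) : Continuous fun t => branchPath T t r :=
  continuous_tsum (fun j => (continuous_branchRamp T j).mul continuous_const)
    (summable_geometric_of_lt_one (r := (1 / 2 : ℝ)) (by norm_num) (by norm_num))
    fun j t => abs_branchPath_term_le T t r j

lemma measurable_branchPath (T : ℝ) : Measurable fun p : ℝ × ℝ => branchPath T p.1 p.2 := by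
  refine measurable_of_tendsto_metrizable (f := fun n (p : ℝ × ℝ) =>
    ∑ j ∈ Finset.range n, branchRamp T j p.1 * dyadicIncr j p.2) (fun n => ?_)
    (tendsto_pi_nhds.2 fun p => (summable_branchPath T p.1 p.2).hasSum.tendsto_sum_nat)
  refine Finset.measurable_sum _ fun j _ => ?_
  exact ((continuous_branchRamp T j).measurable.comp measurable_fst).mul
    ((measurable_dyadicIncr j).comp measurable_snd)

/-- At `t² = T²` all branchings are complete and the sum telescopes. -/
lemma branchPath_of_sq_eq (hT : 0 < T) {t r : ℝ} (ht : t ^ 2 = T ^ 2)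
    (hr : r ∈ Set.Ioc (0 : ℝ) 1) : branchPath T t r = r := by
  have h1 := (summable_branchPath T t r).hasSum.tendsto_sum_nat
  refine tendsto_nhds_unique h1 ((tendsto_dyadic r).congr fun n => ?_)
  have h2 : ∀ j, branchRamp T j t = 1 := fun j =>
    branchRamp_of_ge hT (by rw [ht]; exact (branchTime_lt hT _).le)
  simp only [h2, one_mul, dyadicIncr, Finset.sum_range_sub (fun j => dyadic j r), dyadic_zero hr,
    sub_zero]

lemma branchPath_eq_sum (hT : 0 < T) {t : ℝ} {n : ℕ} (h : t ^ 2 ≤ branchTime T n) (r : ℝ) :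
    branchPath T t r = ∑ j ∈ Finset.range n, branchRamp T j t * dyadicIncr j r := by
  refine tsum_eq_sum fun j hj => ?_
  rw [Finset.mem_range, not_lt] at hj
  rw [branchRamp_of_le hT (h.trans (branchTime_mono hT hj)), zero_mul]

lemma branchSpeed_eq_sum (hT : 0 < T) {t : ℝ} {n : ℕ} (h : t ^ 2 ≤ branchTime T n) (r : ℝ) :
    branchSpeed T t r = ∑ j ∈ Finset.range n, deriv (branchRamp T j) t * dyadicIncr j r := by
  refine tsum_eq_sum fun j hj => ?_
  rw [Finset.mem_range, not_lt] at hj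
  rw [deriv_branchRamp_of_le hT (h.trans (branchTime_mono hT hj)), zero_mul]

/-- During the `J`-th branching period only the `J`-th displacement is in progress. -/
lemma branchSpeed_eq_single (hT : 0 < T) {t : ℝ} {J : ℕ} (h1 : branchTime T J ≤ t ^ 2)
    (h2 : t ^ 2 < branchTime T (J + 1)) (r : ℝ) :
    branchSpeed T t r = deriv (branchRamp T J) t * dyadicIncr J r := by
  refine tsum_eq_single J fun j hj => ?_
  rcases lt_or_gt_of_ne hj with hj | hj
  · rw [deriv_branchRamp_of_ge hT ((branchTime_mono hT hj).trans h1), zero_mul]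
  · rw [deriv_branchRamp_of_le hT (h2.le.trans (branchTime_mono hT hj)), zero_mul]

lemma hasDerivAt_branchPath (hT : 0 < T) {t : ℝ} (ht : t ∈ Set.Ioo (-T) T) (r : ℝ) :
    HasDerivAt (fun t => branchPath T t r) (branchSpeed T t r) t := by
  obtain ⟨J, -, h2⟩ := exists_branchTime ht
  rw [branchSpeed_eq_sum hT h2.le]
  have h3 : HasDerivAt (fun t => ∑ j ∈ Finset.range (J + 1), branchRamp T j t * dyadicIncr j r)
      (∑ j ∈ Finset.range (J + 1), deriv (branchRamp T j) t * dyadicIncr j r) t :=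
    HasDerivAt.fun_sum fun j _ =>
      ((hasDerivAt_branchRamp T j t).differentiableAt.hasDerivAt).mul_const _
  refine h3.congr_of_eventuallyEq ?_
  have h4 : ∀ᶠ s : ℝ in 𝓝 t, s ^ 2 < branchTime T (J + 1) :=
    (continuous_pow 2).continuousAt.eventually (gt_mem_nhds h2)
  filter_upwards [h4] with s hs using branchPath_eq_sum hT hs.le r

lemma summable_branchSpeed (hT : 0 < T) (t r : ℝ) :
    Summable fun j => deriv (branchRamp T j) t * dyadicIncr j r := by
  by_cases ht : t ∈ Set.Ioo (-T) T
  · obtain ⟨J, -, h2⟩ := exists_branchTime ht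
    refine summable_of_ne_finset_zero (s := Finset.range (J + 1)) fun j hj => ?_
    rw [Finset.mem_range, not_lt] at hj
    rw [deriv_branchRamp_of_le hT (h2.le.trans (branchTime_mono hT hj)), zero_mul]
  · have h1 : T ^ 2 ≤ t ^ 2 := by
      by_contra h
      exact ht (abs_lt.1 (by simpa [abs_of_pos hT] using sq_lt_sq.1 (not_le.1 h)))
    refine (summable_zero (α := ℝ) (β := ℕ)).congr fun j => ?_
    rw [deriv_branchRamp_of_ge hT ((branchTime_lt hT _).le.trans h1), zero_mul]

lemma measurable_branchSpeed (hT : 0 < T) :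
    Measurable fun p : ℝ × ℝ => branchSpeed T p.1 p.2 := by
  refine measurable_of_tendsto_metrizable (f := fun n (p : ℝ × ℝ) =>
    ∑ j ∈ Finset.range n, deriv (branchRamp T j) p.1 * dyadicIncr j p.2) (fun n => ?_)
    (tendsto_pi_nhds.2 fun p => (summable_branchSpeed hT p.1 p.2).hasSum.tendsto_sum_nat)
  refine Finset.measurable_sum _ fun j _ => ?_
  exact ((measurable_deriv _).comp measurable_fst).mul
    ((measurable_dyadicIncr j).comp measurable_snd)

/-- The `J`-th branching period inside `(-T, T)`. -/
def branchPeriod (T : ℝ) (J : ℕ) : Set ℝ :=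
  {t | t ∈ Set.Ioo (-T) T ∧ branchTime T J ≤ t ^ 2 ∧ t ^ 2 < branchTime T (J + 1)}

lemma measurableSet_branchPeriod (T : ℝ) (J : ℕ) : MeasurableSet (branchPeriod T J) := by
  have h : Measurable fun t : ℝ => t ^ 2 := by fun_prop
  exact measurableSet_Ioo.inter ((measurableSet_le measurable_const h).inter
    (measurableSet_lt h measurable_const))

lemma volume_branchPeriod_le (hT : 0 < T) (J : ℕ) :
    volume (branchPeriod T J) ≤ ENNReal.ofReal (2 * T * (1 / 3) ^ J) := by
  set q : ℝ := (1 / 3) ^ J with hq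
  have hq0 : 0 < q := by positivity
  have hsub : branchPeriod T J ⊆ Set.Icc (-T) (-T + T * q) ∪ Set.Icc (T - T * q) T := by
    rintro t ⟨ht, h1, -⟩
    have h2 : T ^ 2 * (1 - q) ≤ t ^ 2 := h1
    rcases le_total 0 t with h0 | h0
    · right
      have h3 : T * (T * (1 - q)) ≤ T * t := by nlinarith [ht.2]
      have := le_of_mul_le_mul_left h3 hT
      exact ⟨by linarith, ht.2.le⟩
    · left
      have h3 : T * (T * (1 - q)) ≤ T * (-t) := by nlinarith [ht.1]
      have := le_of_mul_le_mul_left h3 hT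
      exact ⟨ht.1.le, by linarith⟩
  refine (measure_mono hsub).trans ((measure_union_le _ _).trans ?_)
  rw [Real.volume_Icc, Real.volume_Icc, ← ENNReal.ofReal_add (by nlinarith) (by nlinarith)]
  exact ENNReal.ofReal_le_ofReal (by linarith)

lemma tsum_ofReal_geometric_ne_top {C r : ℝ} (hC : 0 ≤ C) (hr0 : 0 ≤ r) (hr1 : r < 1) :
    ∑' j : ℕ, ENNReal.ofReal (C * r ^ j) ≠ ⊤ := by
  rw [← ENNReal.ofReal_tsum_of_nonneg (fun j => by positivity)
    ((summable_geometric_of_lt_one hr0 hr1).mul_left C)]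
  exact ENNReal.ofReal_ne_top

end

/-! ### A branching tree of finite energy -/

section

variable {d : ℕ} {T : ℝ}

/-- The half-open unit cube. -/
def unitCube (d : ℕ) : Set (Fin d → ℝ) := Set.univ.pi fun _ => Set.Ioc 0 1

/-- Lebesgue measure on the unit cube. -/
def cubeMeasure (d : ℕ) : Measure (Fin d → ℝ) := volume.restrict (unitCube d)

lemma measurableSet_unitCube : MeasurableSet (unitCube d) :=
  MeasurableSet.univ_pi fun _ => measurableSet_Ioc

lemma cubeMeasure_eq_pi :
    cubeMeasure d = Measure.pi fun _ : Fin d => volume.restrict (Set.Ioc (0 : ℝ) 1) :=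
  Measure.restrict_pi_pi _ _

instance isProbabilityMeasure_cubeMeasure : IsProbabilityMeasure (cubeMeasure d) := by
  refine ⟨?_⟩
  rw [cubeMeasure_eq_pi, ← Set.pi_univ Set.univ, Measure.pi_pi]
  simp

lemma map_torusMk_cubeMeasure :
    (cubeMeasure d).map torusMk = (volume : Measure (UnitAddTorus (Fin d))) := by
  rw [cubeMeasure_eq_pi]
  have h := measurePreserving_pi (fun _ : Fin d => volume.restrict (Set.Ioc (0 : ℝ) 1))
    (fun _ : Fin d => (volume : Measure UnitAddCircle)) (fun _ => by
      simpa using UnitAddCircle.measurePreserving_mk 0)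
  exact h.map_eq

/-- A set which contains, with each of its points in the cube, the whole dyadic cell of that point,
is either null or at least as large as one cell. -/
lemma le_cubeMeasure_of_saturated {N : ℕ} {s : Set (Fin d → ℝ)}
    (hs : ∀ u ∈ s, ∀ u', (∀ i, ⌈(2 : ℝ) ^ N * u i⌉ = ⌈(2 : ℝ) ^ N * u' i⌉) → u' ∈ s)
    (h0 : cubeMeasure d s ≠ 0) : (ENNReal.ofReal ((1 / 2) ^ N)) ^ d ≤ cubeMeasure d s := by
  obtain ⟨u, hus, huc⟩ : ∃ u, u ∈ s ∧ u ∈ unitCube d := by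
    by_contra hne
    push Not at hne
    refine h0 (measure_mono_null (t := (unitCube d)ᶜ) hne ?_)
    exact mem_ae_iff.1 (ae_restrict_mem measurableSet_unitCube)
  set c : Fin d → ℤ := fun i => ⌈(2 : ℝ) ^ N * u i⌉ with hc
  have hpow : (0 : ℝ) < 2 ^ N := by positivity
  have hsub : Set.univ.pi (fun i => Set.Ioc (((c i : ℝ) - 1) / 2 ^ N) ((c i : ℝ) / 2 ^ N)) ⊆ s := by
    intro u' hu'
    refine hs u hus u' fun i => ?_
    have hi := hu' i trivial
    refine (Int.ceil_eq_iff.2 ⟨?_, ?_⟩).symm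
    · have := (div_lt_iff₀ hpow).1 hi.1
      linarith
    · have := (le_div_iff₀ hpow).1 hi.2
      linarith
  refine le_trans ?_ (measure_mono hsub)
  rw [cubeMeasure_eq_pi, Measure.pi_pi]
  have hcell : ∀ i, ENNReal.ofReal ((1 / 2) ^ N) ≤ (volume.restrict (Set.Ioc (0 : ℝ) 1))
      (Set.Ioc (((c i : ℝ) - 1) / 2 ^ N) ((c i : ℝ) / 2 ^ N)) := by
    intro i
    have hui := huc i trivial
    have h1 : (1 : ℝ) ≤ c i := by
      have : (0 : ℤ) < c i := Int.ceil_pos.2 (mul_pos hpow hui.1)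
      exact_mod_cast this
    have h2 : (c i : ℝ) ≤ 2 ^ N := by
      have : c i ≤ 2 ^ N := Int.ceil_le.2 (by
        push_cast
        exact mul_le_of_le_one_right hpow.le hui.2)
      exact_mod_cast this
    rw [Measure.restrict_apply measurableSet_Ioc, Set.inter_eq_left.2, Real.volume_Ioc]
    · refine ENNReal.ofReal_le_ofReal (le_of_eq ?_)
      rw [← sub_div, sub_sub_cancel, div_pow, one_pow]
    · exact Set.Ioc_subset_Ioc (div_nonneg (by linarith) hpow.le) ((div_le_one hpow).2 h2)
  calc (ENNReal.ofReal ((1 / 2) ^ N)) ^ d = ∏ _i : Fin d, ENNReal.ofReal ((1 / 2) ^ N) := by simp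
    _ ≤ _ := Finset.prod_le_prod' fun i _ => hcell i

/-- The position at time `t` of the particle that ends at `u`. -/
def branchPos (T t : ℝ) (u : Fin d → ℝ) : Fin d → ℝ := fun i => branchPath T t (u i)

/-- The velocity of `branchPos`. -/
def branchVel (T t : ℝ) (u : Fin d → ℝ) : EuclideanSpace ℝ (Fin d) :=
  WithLp.toLp 2 fun i => branchSpeed T t (u i)

/-- The space-time position of the particle that ends at `u`. -/
def branchMap (T : ℝ) (θ : ℝ × (Fin d → ℝ)) : ℝ × UnitAddTorus (Fin d) :=
  (θ.1, torusMk (branchPos T θ.1 θ.2))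

lemma measurable_branchMap : Measurable (branchMap (d := d) T) := by
  have hpos : Measurable fun θ : ℝ × (Fin d → ℝ) => branchPos T θ.1 θ.2 :=
    measurable_pi_lambda _ fun i => by
      have h : Measurable fun θ : ℝ × (Fin d → ℝ) => (θ.1, θ.2 i) := by fun_prop
      have h2 := (measurable_branchPath T).comp h
      exact h2
  exact measurable_fst.prodMk (continuous_torusMk.measurable.comp hpos)

lemma measurable_torusMk_branchPos (t : ℝ) :
    Measurable fun u : Fin d → ℝ => torusMk (branchPos T t u) :=
  (measurable_branchMap.comp measurable_prodMk_left).snd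

lemma measurable_branchVel (hT : 0 < T) :
    Measurable fun θ : ℝ × (Fin d → ℝ) => branchVel T θ.1 θ.2 := by
  refine (PiLp.continuous_toLp 2 _).measurable.comp (measurable_pi_lambda _ fun i => ?_)
  have h : Measurable fun θ : ℝ × (Fin d → ℝ) => (θ.1, θ.2 i) := by fun_prop
  have h2 := (measurable_branchSpeed hT).comp h
  exact h2

/-- The branching tree whose traces at `±T` are Lebesgue measure: the law of `branchPos` under a
uniformly distributed end point. -/
def branchKernel (d : ℕ) (T : ℝ) : Kernel ℝ (UnitAddTorus (Fin d)) where
  toFun t := (cubeMeasure d).map fun u => torusMk (branchPos T t u)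
  measurable' := by
    refine Measure.measurable_of_measurable_coe _ fun s hs => ?_
    have h := measurable_measure_prodMk_left (ν := cubeMeasure d)
      ((measurable_branchMap (T := T)).snd hs)
    have heq : (fun t => (cubeMeasure d).map (fun u => torusMk (branchPos T t u)) s) =
        fun t => cubeMeasure d (Prod.mk t ⁻¹' ((fun θ => (branchMap T θ).2) ⁻¹' s)) :=
      funext fun t => by
        rw [Measure.map_apply (measurable_torusMk_branchPos t) hs]
        rfl
    rw [heq]
    exact h

lemma branchKernel_apply (t : ℝ) :
    branchKernel d T t = (cubeMeasure d).map fun u => torusMk (branchPos T t u) := rfl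

instance isMarkovKernel_branchKernel : IsMarkovKernel (branchKernel d T) :=
  ⟨fun t => Measure.isProbabilityMeasure_map (measurable_torusMk_branchPos t).aemeasurable⟩

lemma branchPath_congr (hT : 0 < T) {t : ℝ} {N : ℕ} (ht : t ^ 2 ≤ branchTime T N) {r r' : ℝ}
    (h : ⌈(2 : ℝ) ^ N * r⌉ = ⌈(2 : ℝ) ^ N * r'⌉) : branchPath T t r = branchPath T t r' := by
  rw [branchPath_eq_sum hT ht, branchPath_eq_sum hT ht]
  refine Finset.sum_congr rfl fun j hj => ?_
  have hjN := Finset.mem_range.1 hj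
  simp only [dyadicIncr, dyadic, ceil_eq_of_le (show j ≤ N by omega) h,
    ceil_eq_of_le (show j + 1 ≤ N by omega) h]

lemma branchPos_congr (hT : 0 < T) {t : ℝ} {N : ℕ} (ht : t ^ 2 ≤ branchTime T N)
    {u u' : Fin d → ℝ} (h : ∀ i, ⌈(2 : ℝ) ^ N * u i⌉ = ⌈(2 : ℝ) ^ N * u' i⌉) :
    branchPos T t u = branchPos T t u' :=
  funext fun i => branchPath_congr hT ht (h i)

lemma isAtomic_branchKernel (hT : 0 < T) {t : ℝ} (ht : t ∈ Set.Ioo (-T) T) :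
    IsAtomic (branchKernel d T t) := by
  obtain ⟨J, -, h2⟩ := exists_branchTime ht
  -- one representative for each dyadic cell of generation `J + 1`
  let S : Set (UnitAddTorus (Fin d)) :=
    Set.range fun c : Fin d → ℤ => torusMk (branchPos T t fun i => (c i : ℝ) / 2 ^ (J + 1))
  have hS : S.Countable := Set.countable_range _
  refine ⟨S, hS, ?_⟩
  rw [branchKernel_apply, Measure.map_apply (measurable_torusMk_branchPos t)
    hS.measurableSet.compl]
  convert measure_empty (μ := cubeMeasure d)
  rw [Set.preimage_compl, Set.compl_empty_iff, Set.eq_univ_iff_forall]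
  intro u
  refine ⟨fun i => ⌈(2 : ℝ) ^ (J + 1) * u i⌉, ?_⟩
  simp only
  rw [branchPos_congr hT h2.le]
  intro i
  rw [mul_div_cancel₀ _ (by positivity), Int.ceil_intCast]

lemma slicePerimeter_branchKernel_le (hd : 1 ≤ d) (hT : 0 < T) {t : ℝ} {J : ℕ}
    (ht : t ^ 2 < branchTime T (J + 1)) :
    slicePerimeter (branchKernel d T t) ≤ ENNReal.ofReal (2 ^ (J + 1)) := by
  have h := slicePerimeter_le_of_le_atoms hd (branchKernel d T t) (by simp)
    (q := (ENNReal.ofReal ((1 / 2) ^ (J + 1))) ^ d) fun x hx => ?_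
  · refine h.trans (le_of_eq ?_)
    rw [← ENNReal.rpow_natCast, ← ENNReal.rpow_mul]
    have h1 : (d : ℝ) * -(1 / (d : ℝ)) = -1 := by
      have : (d : ℝ) ≠ 0 := by exact_mod_cast (by omega : d ≠ 0)
      field_simp
    rw [h1, ENNReal.rpow_neg_one, ← ENNReal.ofReal_inv_of_pos (by positivity)]
    simp
  · rw [branchKernel_apply, Measure.map_apply (measurable_torusMk_branchPos t)
      (measurableSet_singleton x)] at hx ⊢
    refine le_cubeMeasure_of_saturated (fun u hu u' huu' => ?_) hx
    rw [Set.mem_preimage, Set.mem_singleton_iff] at hu ⊢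
    rw [← hu, branchPos_congr hT ht.le huu']

lemma setLIntegral_le_tsum_branchPeriod {F : ℝ → ℝ≥0∞} {c : ℕ → ℝ≥0∞}
    (h : ∀ J, ∀ t ∈ branchPeriod T J, F t ≤ c J) :
    ∫⁻ t in Set.Ioo (-T) T, F t ≤ ∑' J, c J * volume (branchPeriod T J) := by
  calc ∫⁻ t in Set.Ioo (-T) T, F t
      ≤ ∫⁻ t in Set.Ioo (-T) T, ∑' J, (branchPeriod T J).indicator (fun _ => c J) t := by
        refine setLIntegral_mono' measurableSet_Ioo fun t ht => ?_
        obtain ⟨J, hJ⟩ := exists_branchTime ht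
        have hmem : t ∈ branchPeriod T J := ⟨ht, hJ⟩
        refine (h J t hmem).trans (le_trans (le_of_eq ?_) (ENNReal.le_tsum J))
        rw [Set.indicator_of_mem hmem]
    _ ≤ ∫⁻ t, ∑' J, (branchPeriod T J).indicator (fun _ => c J) t :=
        setLIntegral_le_lintegral _ _
    _ = ∑' J, c J * volume (branchPeriod T J) := by
        rw [lintegral_tsum fun J =>
          (measurable_const.indicator (measurableSet_branchPeriod T J)).aemeasurable]
        refine tsum_congr fun J => ?_
        rw [lintegral_indicator_const (measurableSet_branchPeriod T J)]

lemma perimeter_branchKernel_ne_top (hd : 1 ≤ d) (hT : 0 < T) :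
    perimeter (branchKernel d T) (-T) T ≠ ⊤ := by
  refine ne_top_of_le_ne_top (tsum_ofReal_geometric_ne_top (C := 4 * T) (r := 2 / 3)
    (by positivity) (by norm_num) (by norm_num)) ?_
  refine (setLIntegral_le_tsum_branchPeriod fun J t ht =>
    slicePerimeter_branchKernel_le hd hT ht.2.2).trans (ENNReal.tsum_le_tsum fun J => ?_)
  refine (mul_le_mul_right (volume_branchPeriod_le hT J) _).trans (le_of_eq ?_)
  rw [← ENNReal.ofReal_mul (by positivity)]
  congr 1
  rw [pow_succ, show (2 / 3 : ℝ) = 2 * (1 / 3) by norm_num, mul_pow]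
  ring

lemma enorm_branchVel_sq_le {C : ℝ} (hT : 0 < T)
    (hC : ∀ j, ∀ t ∈ Set.Ioo (-T) T, |deriv (branchRamp T j) t| ≤ C * 3 ^ j) {J : ℕ} {t : ℝ}
    (ht : t ∈ branchPeriod T J) (u : Fin d → ℝ) :
    ‖branchVel T t u‖ₑ ^ 2 ≤ ENNReal.ofReal (d * C ^ 2 * (9 / 4) ^ J) := by
  rw [← ofReal_norm, ← ENNReal.ofReal_pow (norm_nonneg _), EuclideanSpace.norm_sq_eq]
  refine ENNReal.ofReal_le_ofReal ?_
  have h1 : ∀ i, ‖(branchVel T t u).ofLp i‖ ^ 2 ≤ C ^ 2 * (9 / 4) ^ J := by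
    intro i
    have h2 : ‖(branchVel T t u).ofLp i‖ ≤ C * 3 ^ J * (1 / 2) ^ J := by
      simp only [branchVel, branchSpeed_eq_single hT ht.2.1 ht.2.2, norm_mul]
      exact mul_le_mul (hC J t ht.1) (abs_dyadicIncr_le J _) (norm_nonneg _)
        ((abs_nonneg _).trans (hC J t ht.1))
    refine (pow_le_pow_left₀ (norm_nonneg _) h2 2).trans (le_of_eq ?_)
    rw [mul_assoc, ← mul_pow, mul_pow, ← pow_mul, mul_comm J 2, pow_mul]
    norm_num
  refine (Finset.sum_le_sum fun i _ => h1 i).trans (le_of_eq ?_)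
  simp
  ring

lemma lintegral_branchVel_ne_top (hT : 0 < T) :
    ∫⁻ θ, ‖branchVel T θ.1 θ.2‖ₑ ^ 2
      ∂((volume.restrict (Set.Ioo (-T) T)).prod (cubeMeasure d)) ≠ ⊤ := by
  obtain ⟨C, hC0, hC⟩ := exists_bound_deriv_branchRamp hT
  rw [lintegral_prod _ ((measurable_branchVel hT).enorm.pow_const 2).aemeasurable]
  refine ne_top_of_le_ne_top (tsum_ofReal_geometric_ne_top (C := 2 * T * (d * C ^ 2)) (r := 3 / 4)
    (by positivity) (by norm_num) (by norm_num)) ?_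
  refine (setLIntegral_le_tsum_branchPeriod (c := fun J => ENNReal.ofReal (d * C ^ 2 * (9 / 4) ^ J))
    fun J t ht => ?_).trans (ENNReal.tsum_le_tsum fun J => ?_)
  · refine (lintegral_mono fun u => enorm_branchVel_sq_le hT hC ht u).trans ?_
    simp
  · refine (mul_le_mul_right (volume_branchPeriod_le hT J) _).trans (le_of_eq ?_)
    rw [← ENNReal.ofReal_mul (by positivity)]
    congr 1
    rw [show (3 / 4 : ℝ) = 9 / 4 * (1 / 3) by norm_num, mul_pow]
    ring

lemma map_branchMap (a b : ℝ) :
    ((volume.restrict (Set.Ioo a b)).prod (cubeMeasure d)).map (branchMap T) =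
      spaceTime (branchKernel d T) a b := by
  refine Measure.ext_of_lintegral _ fun f hf => ?_
  rw [lintegral_map hf measurable_branchMap,
    lintegral_prod (fun θ => f (branchMap T θ)) (hf.comp measurable_branchMap).aemeasurable,
    spaceTime, Measure.lintegral_compProd hf]
  refine lintegral_congr fun t => ?_
  have hft : Measurable fun x => f (t, x) := hf.comp measurable_prodMk_left
  rw [branchKernel_apply, lintegral_map hft (measurable_torusMk_branchPos t)]
  rfl

/-- Along each particle path, the total time derivative of a test function integrates to zero. -/
lemma integral_branchPos_eq_zero (hT : 0 < T) {ψ : ℝ × UnitAddTorus (Fin d) → ℝ}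
    (hψ : IsTest (-T) T ψ) (u : Fin d → ℝ)
    (hint : Integrable (fun t => timeDeriv ψ (branchMap T (t, u)) +
      ∑ j, spaceDeriv ψ j (branchMap T (t, u)) * branchVel T t u j)
      (volume.restrict (Set.Ioo (-T) T))) :
    ∫ t in Set.Ioo (-T) T, (timeDeriv ψ (branchMap T (t, u)) +
      ∑ j, spaceDeriv ψ j (branchMap T (t, u)) * branchVel T t u j) = 0 := by
  have hout : ∀ t, t ∉ Set.Ioo (-T) T → branchMap T (t, u) ∉ tsupport ψ :=
    fun t ht h => ht (hψ.support h).1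
  have hcont : Continuous fun t => branchMap T (t, u) :=
    continuous_id.prodMk (continuous_torusMk.comp
      (continuous_pi fun i => continuous_branchPath T (u i)))
  have hderiv : ∀ t, HasDerivAt (fun t => ψ (branchMap T (t, u)))
      (timeDeriv ψ (branchMap T (t, u)) +
        ∑ j, spaceDeriv ψ j (branchMap T (t, u)) * branchVel T t u j) t := by
    intro t
    by_cases ht : t ∈ Set.Ioo (-T) T
    · have hy : HasDerivAt (fun t => branchPos T t u) (fun i => branchSpeed T t (u i)) t :=
        hasDerivAt_pi.2 fun i => hasDerivAt_branchPath hT ht (u i)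
      exact hψ.hasDerivAt_comp hy
    · have h0 := hout t ht
      have h1 : (fun t => ψ (branchMap T (t, u))) =ᶠ[𝓝 t] fun _ => 0 :=
        hcont.continuousAt.eventually (notMem_tsupport_iff_eventuallyEq.1 h0)
      simp only [timeDeriv_eq_zero h0, spaceDeriv_eq_zero h0, zero_mul, Finset.sum_const_zero,
        add_zero]
      exact (hasDerivAt_const t (0 : ℝ)).congr_of_eventuallyEq h1
  rw [← integral_Ioc_eq_integral_Ioo, ← intervalIntegral.integral_of_le (by linarith),
    intervalIntegral.integral_eq_sub_of_hasDerivAt (fun t _ => hderiv t)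
      ((intervalIntegrable_iff_integrableOn_Ioo_of_le (by linarith)).2 hint),
    image_eq_zero_of_notMem_tsupport (hout T (by simp)),
    image_eq_zero_of_notMem_tsupport (hout (-T) (by simp)), sub_zero]

lemma exists_isVelocity_branchKernel (hT : 0 < T) :
    ∃ v, IsVelocity (branchKernel d T) (-T) T v ∧ kinetic (branchKernel d T) (-T) T v ≠ ⊤ := by
  set Q := (volume.restrict (Set.Ioo (-T) T)).prod (cubeMeasure d) with hQ
  have hw : MemLp (fun θ : ℝ × (Fin d → ℝ) => branchVel T θ.1 θ.2) 2 Q := by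
    refine ⟨(measurable_branchVel hT).aestronglyMeasurable, ?_⟩
    rw [eLpNorm_lt_top_iff_lintegral_rpow_enorm_lt_top two_ne_zero ENNReal.ofNat_ne_top]
    simpa using (lintegral_branchVel_ne_top hT).lt_top
  obtain ⟨v, hv, hk⟩ := exists_isVelocity_of_lift (Q := Q) measurable_branchMap
    (map_branchMap (-T) T) hw fun ψ hψ => by
      have hint : Integrable (fun θ => timeDeriv ψ (branchMap T θ) +
          ∑ j, spaceDeriv ψ j (branchMap T θ) * branchVel T θ.1 θ.2 j) Q := by
        simp only [← inner_spaceGrad]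
        exact (hψ.integrable_timeDeriv measurable_branchMap).add
          (hψ.integrable_inner measurable_branchMap (hw.integrable one_le_two))
      rw [integral_prod_symm _ hint]
      refine integral_eq_zero_of_ae ?_
      filter_upwards [hint.prod_left_ae] with u hu
      exact integral_branchPos_eq_zero hT hψ u hu
  exact ⟨v, hv, ne_top_of_le_ne_top (lintegral_branchVel_ne_top hT) hk⟩

lemma isTrace_branchKernel (hT : 0 < T) {t₀ : ℝ} (ht₀ : t₀ ^ 2 = T ^ 2) {l : Filter ℝ}
    (hl : l ≤ 𝓝 t₀) : IsTrace (branchKernel d T) l volume := by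
  refine ⟨inferInstance, fun f => ?_⟩
  have hcont : Continuous fun t => ∫ u, f (torusMk (branchPos T t u)) ∂(cubeMeasure d) := by
    refine continuous_of_dominated (bound := fun _ => ‖f‖) (fun t => ?_) (fun t => ?_)
      (integrable_const _) ?_
    · exact (f.continuous.measurable.comp (measurable_torusMk_branchPos t)).aestronglyMeasurable
    · exact ae_of_all _ fun u => f.norm_coe_le_norm _
    · exact ae_of_all _ fun u => f.continuous.comp (continuous_torusMk.comp
        (continuous_pi fun i => continuous_branchPath T (u i)))
  have h1 : ∀ t, ∫ x, f x ∂(branchKernel d T t) =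
      ∫ u, f (torusMk (branchPos T t u)) ∂(cubeMeasure d) := fun t => by
    rw [branchKernel_apply, integral_map (measurable_torusMk_branchPos t).aemeasurable
      f.continuous.aestronglyMeasurable]
  have h2 : ∫ x, f x ∂(volume : Measure (UnitAddTorus (Fin d))) =
      ∫ u, f (torusMk (branchPos T t₀ u)) ∂(cubeMeasure d) := by
    rw [← map_torusMk_cubeMeasure, integral_map continuous_torusMk.measurable.aemeasurable
      f.continuous.aestronglyMeasurable]
    refine integral_congr_ae ?_
    filter_upwards [ae_restrict_mem (measurableSet_unitCube (d := d))] with u hu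
    have : branchPos T t₀ u = u := funext fun i => branchPath_of_sq_eq hT ht₀ (hu i trivial)
    rw [this]
  simp only [h1, h2]
  exact (hcont.tendsto t₀).mono_left (inf_le_left.trans hl)

/-- The class of admissible measures contains one of finite energy, so that the energy of a
minimizer is finite. -/
theorem exists_admissible_totalEnergy_ne_top (hd : 1 ≤ d) (hT : 0 < T) (s : ℝ) :
    ∃ ν : Kernel ℝ (UnitAddTorus (Fin d)), Admissible (-T) T ν ∧ totalEnergy s T ν ≠ ⊤ := by
  obtain ⟨v, hv, hk⟩ := exists_isVelocity_branchKernel (d := d) hT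
  refine ⟨branchKernel d T, ⟨inferInstance, ?_, v, hv⟩, ?_⟩
  · filter_upwards [ae_restrict_mem measurableSet_Ioo] with t ht using isAtomic_branchKernel hT ht
  · have h1 : traceTop T (branchKernel d T) = volume :=
      (isTrace_branchKernel hT rfl inf_le_left).trace_eq (neBot_nhdsLT_inf_ae T)
    have h2 : traceBot T (branchKernel d T) = volume :=
      (isTrace_branchKernel hT (by ring) inf_le_left).trace_eq (neBot_nhdsGT_inf_ae (-T))
    rw [totalEnergy, h1, h2, deviationSq_volume, add_zero, add_zero]
    exact ne_top_of_le_ne_top (ENNReal.add_ne_top.2 ⟨perimeter_branchKernel_ne_top hd hT, hk⟩)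
      (iInf₂_le v hv)

end

/-! ### Comparison of a minimizer with its splitting -/

section

variable {d : ℕ} {T : ℝ}

section Trace

variable {μ : Kernel ℝ (UnitAddTorus (Fin d))} [IsFiniteKernel μ] {g : ℝ → Fin d → ℝ}

lemma tendsto_integral_translate (hg : Continuous g) {t₀ : ℝ} {l : Filter ℝ} (hl : l ≤ 𝓝 t₀)
    {ρ : Measure (UnitAddTorus (Fin d))} (h : IsTrace μ l ρ) (f : C(UnitAddTorus (Fin d), ℝ)) :
    Tendsto (fun t => ∫ x, f (x + torusMk (g t)) ∂(μ t)) (l ⊓ ae volume)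
      (𝓝 (∫ x, f (x + torusMk (g t₀)) ∂ρ)) := by
  have hmk := continuous_torusMk (d := d)
  -- the translates of `f` depend continuously on `t` in the uniform norm
  let F : C(ℝ, C(UnitAddTorus (Fin d), ℝ)) :=
    ContinuousMap.curry ⟨fun p : ℝ × UnitAddTorus (Fin d) => f (p.2 + torusMk (g p.1)), by fun_prop⟩
  have hint : ∀ t (u : C(UnitAddTorus (Fin d), ℝ)), Integrable u (μ t) := fun t u =>
    u.continuous.integrable_of_hasCompactSupport (HasCompactSupport.of_compactSpace u)
  have h1 : Tendsto (fun t => ∫ x, F t₀ x ∂(μ t)) (l ⊓ ae volume) (𝓝 (∫ x, F t₀ x ∂ρ)) := h.2 _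
  have h2 : Tendsto (fun t => ∫ x, F t x ∂(μ t) - ∫ x, F t₀ x ∂(μ t)) (l ⊓ ae volume) (𝓝 0) := by
    have h3 : Tendsto (fun t => ‖F t - F t₀‖ * μ.bound.toReal) (l ⊓ ae volume) (𝓝 0) := by
      have h4 : Tendsto (fun t => ‖F t - F t₀‖ * μ.bound.toReal) (𝓝 t₀) (𝓝 0) := by
        have h5 : Continuous fun t => ‖F t - F t₀‖ * μ.bound.toReal := by fun_prop
        simpa using h5.tendsto t₀
      exact h4.mono_left (inf_le_left.trans hl)
    refine squeeze_zero_norm (fun t => ?_) h3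
    rw [← integral_sub (hint t (F t)) (hint t (F t₀))]
    refine (norm_integral_le_of_norm_le_const (ae_of_all _ fun x =>
      (F t - F t₀).norm_coe_le_norm x)).trans ?_
    refine mul_le_mul_of_nonneg_left ?_ (norm_nonneg _)
    exact ENNReal.toReal_mono μ.bound_ne_top (μ.measure_le_bound t _)
  simpa [F] using h2.add h1

/-- The trace of the split measure is the split trace. -/
lemma IsTrace.splitKernel (hg : Continuous g) {t₀ : ℝ} {l : Filter ℝ} (hl : l ≤ 𝓝 t₀)
    {ρ : Measure (UnitAddTorus (Fin d))} [IsFiniteMeasure ρ] (h : IsTrace μ l ρ) :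
    IsTrace (splitKernel μ g hg) l (BranchedTransport.splitKernel (Kernel.const ℝ ρ) g hg t₀) := by
  refine ⟨inferInstance, fun f => ?_⟩
  simp only [integral_splitKernel, Kernel.const_apply, smul_eq_mul]
  exact ((tendsto_integral_translate hg hl h f).add
    (tendsto_integral_translate hg.neg hl h f)).const_mul _

/-- Splitting multiplies the Fourier coefficients by a cosine. -/
lemma devCoeff_splitKernel (hg : Continuous g) {ρ : Measure (UnitAddTorus (Fin d))}
    [IsFiniteMeasure ρ] (t : ℝ) (k : Fin d → ℤ) :
    devCoeff (splitKernel (Kernel.const ℝ ρ) g hg t) k =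
      Real.cos (2 * Real.pi * ∑ i, k i * g t i) * devCoeff ρ k := by
  have h1 : ∫ x, UnitAddTorus.mFourier k x ∂(splitKernel (Kernel.const ℝ ρ) g hg t) =
      Real.cos (2 * Real.pi * ∑ i, k i * g t i) * ∫ x, UnitAddTorus.mFourier k x ∂ρ := by
    rw [integral_splitKernel]
    simp only [Kernel.const_apply, mFourier_add_arg, integral_mul_const, mFourier_torusMk]
    have h2 : (∑ i, (k i : ℝ) * (-g t) i) = -∑ i, (k i : ℝ) * g t i := by
      simp [Finset.sum_neg_distrib]
    rw [h2, Complex.ofReal_cos, Complex.cos, Complex.real_smul]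
    push_cast
    ring_nf
  by_cases hk : k = 0
  · subst hk
    simp only [devCoeff, h1]
    simp
  · rw [devCoeff_of_ne _ hk, devCoeff_of_ne _ hk, h1]

end Trace

/-- The smooth transition from `0` to `1` on `[T - ε, T]`. -/
def endRamp (T ε t : ℝ) : ℝ := Real.smoothTransition (1 + (t - T) / ε)

lemma contDiff_endRamp (T ε : ℝ) : ContDiff ℝ ∞ (endRamp T ε) :=
  contDiff_smoothTransition.comp
    (contDiff_const.add ((contDiff_id.sub contDiff_const).div_const ε))

lemma endRamp_of_le {ε t : ℝ} (hε : 0 < ε) (ht : t ≤ T - ε) : endRamp T ε t = 0 := by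
  refine Real.smoothTransition.zero_of_nonpos ?_
  have : (t - T) / ε ≤ -1 := by rw [div_le_iff₀ hε]; linarith
  linarith

lemma endRamp_self (T ε : ℝ) : endRamp T ε T = 1 := by
  simp [endRamp]

lemma deriv_endRamp (T ε t : ℝ) :
    deriv (endRamp T ε) t = deriv Real.smoothTransition (1 + (t - T) / ε) / ε := by
  have h1 : HasDerivAt (fun t : ℝ => 1 + (t - T) / ε) (1 / ε) t := by
    simpa using (((hasDerivAt_id' t).sub_const T).div_const ε).const_add 1
  have h2 := ((contDiff_smoothTransition.differentiable (by simp)) (1 + (t - T) / ε)).hasDerivAt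
  rw [show endRamp T ε = Real.smoothTransition ∘ fun t : ℝ => 1 + (t - T) / ε from rfl,
    (h2.comp t h1).deriv, mul_one_div]

/-- The kinetic energy of the displacement by `h` in the time interval `(T - ε, T)`. -/
lemma exists_lintegral_deriv_endRamp_le (μ : Kernel ℝ (UnitAddTorus (Fin d))) [IsFiniteKernel μ] :
    ∃ A : ℝ≥0∞, A ≠ ⊤ ∧ ∀ (T ε : ℝ) (h : Fin d → ℝ), 0 < ε →
      ∫⁻ p, ‖(WithLp.toLp 2 (deriv (fun t => endRamp T ε t • h) p.1) :
        EuclideanSpace ℝ (Fin d))‖ₑ ^ 2 ∂(spaceTime μ (-T) T) ≤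
      A * ENNReal.ofReal (‖(WithLp.toLp 2 h : EuclideanSpace ℝ (Fin d))‖ ^ 2 / ε) := by
  obtain ⟨C, hC0, hC⟩ := exists_bound_deriv_smoothTransition
  refine ⟨μ.bound * ENNReal.ofReal (C ^ 2), ENNReal.mul_ne_top μ.bound_ne_top ENNReal.ofReal_ne_top,
    fun T ε h hε => ?_⟩
  set H := ‖(WithLp.toLp 2 h : EuclideanSpace ℝ (Fin d))‖ with hH
  have hderiv : ∀ t, deriv (fun t => endRamp T ε t • h) t = deriv (endRamp T ε) t • h := fun t =>
    (((contDiff_endRamp T ε).differentiable (by simp)) t).hasDerivAt.smul_const h |>.deriv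
  have hcont : Continuous fun t => deriv (fun t => endRamp T ε t • h) t := by
    simp only [hderiv]
    exact ((contDiff_endRamp T ε).continuous_deriv (by simp)).smul continuous_const
  have hmeas : Measurable fun p : ℝ × UnitAddTorus (Fin d) =>
      ‖(WithLp.toLp 2 (deriv (fun t => endRamp T ε t • h) p.1) :
        EuclideanSpace ℝ (Fin d))‖ₑ ^ 2 := by
    have h1 : Continuous fun p : ℝ × UnitAddTorus (Fin d) =>
        (WithLp.toLp 2 (deriv (fun t => endRamp T ε t • h) p.1) : EuclideanSpace ℝ (Fin d)) :=
      (PiLp.continuous_toLp 2 _).comp (hcont.comp continuous_fst)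
    exact h1.measurable.enorm.pow_const 2
  have hpt : ∀ t ∈ Set.Ioo (-T) T, ∫⁻ _x, ‖(WithLp.toLp 2
      (deriv (fun t => endRamp T ε t • h) t) : EuclideanSpace ℝ (Fin d))‖ₑ ^ 2 ∂(μ t) ≤
      (Set.Ioo (T - ε) T).indicator
        (fun _ => ENNReal.ofReal ((C / ε * H) ^ 2) * μ.bound) t := by
    intro t ht
    rw [hderiv, lintegral_const]
    by_cases hte : T - ε < t
    · rw [Set.indicator_of_mem (show t ∈ Set.Ioo (T - ε) T from ⟨hte, ht.2⟩)]
      refine mul_le_mul' ?_ (μ.measure_le_bound t _)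
      rw [← ofReal_norm, ← ENNReal.ofReal_pow (norm_nonneg _)]
      refine ENNReal.ofReal_le_ofReal (pow_le_pow_left₀ (norm_nonneg _) ?_ 2)
      rw [WithLp.toLp_smul, norm_smul, deriv_endRamp, norm_div, Real.norm_eq_abs,
        Real.norm_of_nonneg hε.le]
      gcongr
      exact hC _
    · have h0 : deriv (endRamp T ε) t = 0 := by
        rw [deriv_endRamp, deriv_smoothTransition_of_nonpos, zero_div]
        have : (t - T) / ε ≤ -1 := by rw [div_le_iff₀ hε]; linarith [not_lt.1 hte]
        linarith
      rw [h0]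
      simp
  rw [spaceTime, Measure.lintegral_compProd hmeas]
  refine (setLIntegral_mono' measurableSet_Ioo hpt).trans ?_
  refine (setLIntegral_le_lintegral _ _).trans (le_of_eq ?_)
  rw [lintegral_indicator_const measurableSet_Ioo, Real.volume_Ioo, sub_sub_cancel,
    mul_comm (ENNReal.ofReal _) μ.bound, mul_assoc, mul_assoc,
    ← ENNReal.ofReal_mul (by positivity), ← ENNReal.ofReal_mul (by positivity)]
  congr 2
  field_simp

section Minimality

variable {s ε : ℝ} {μ : Kernel ℝ (UnitAddTorus (Fin d))} {g : ℝ → Fin d → ℝ}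

lemma IsMinimizer.totalEnergy_ne_top (hd : 1 ≤ d) (hT : 0 < T) (hμ : IsMinimizer s T μ) :
    totalEnergy s T μ ≠ ⊤ := by
  obtain ⟨ν, hν, hE⟩ := exists_admissible_totalEnergy_ne_top hd hT s
  exact ne_top_of_le_ne_top hE (hμ.2 ν hν)

/-- If the translation starts at time `T - ε`, only the perimeter in `(T - ε, T)` is affected. -/
lemma perimeter_splitKernel_le [IsFiniteKernel μ] (hd : 1 ≤ d) (hg : Continuous g)
    (hε : 0 < ε) (hεT : ε < 2 * T) (hg0 : ∀ t ≤ T - ε, g t = 0) :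
    perimeter (splitKernel μ g hg) (-T) T ≤ perimeter μ (-T) T + perimeter μ (T - ε) T := by
  have hunion : Set.Ioo (-T) T = Set.Ioc (-T) (T - ε) ∪ Set.Ioo (T - ε) T :=
    (Set.Ioc_union_Ioo_eq_Ioo (by linarith) (by linarith)).symm
  have hdisj : Disjoint (Set.Ioc (-T) (T - ε)) (Set.Ioo (T - ε) T) :=
    Set.disjoint_left.2 fun t h1 h2 => absurd h1.2 (not_le.2 h2.1)
  have hsplit : ∀ F : ℝ → ℝ≥0∞, ∫⁻ t in Set.Ioo (-T) T, F t =
      (∫⁻ t in Set.Ioc (-T) (T - ε), F t) + ∫⁻ t in Set.Ioo (T - ε) T, F t := fun F => by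
    rw [hunion, lintegral_union measurableSet_Ioo hdisj]
  rw [perimeter, perimeter, hsplit, hsplit (fun t => slicePerimeter (μ t)), add_assoc]
  refine add_le_add (le_of_eq ?_) ?_
  · refine setLIntegral_congr_fun measurableSet_Ioc fun t ht => ?_
    rw [splitKernel_apply_of_eq_zero (hg0 t ht.2)]
  · rw [perimeter, ← two_mul, ← lintegral_const_mul' _ _ ENNReal.ofNat_ne_top]
    exact lintegral_mono fun t => slicePerimeter_splitKernel_le hd t

/-- Comparison of a minimizer with its splitting along `±g` shortly before the final time. -/
theorem IsMinimizer.deviationSq_le (hd : 1 ≤ d) (hs : 0 < s) (hT : 0 < T) [IsFiniteKernel μ]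
    (hμ : IsMinimizer s T μ) (hε : 0 < ε) (hεT : ε < 2 * T) (hgs : ContDiff ℝ ∞ g)
    (hg : Continuous g) (hg0 : ∀ t ≤ T - ε, g t = 0) [IsFiniteMeasure (traceTop T μ)]
    (hfin : ∫⁻ p, ‖(WithLp.toLp 2 (deriv g p.1) : EuclideanSpace ℝ (Fin d))‖ₑ ^ 2
      ∂(spaceTime μ (-T) T) ≠ ⊤) :
    deviationSq s (traceTop T μ) ≤
      (perimeter μ (T - ε) T +
        ∫⁻ p, ‖(WithLp.toLp 2 (deriv g p.1) : EuclideanSpace ℝ (Fin d))‖ₑ ^ 2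
          ∂(spaceTime μ (-T) T)) +
      deviationSq s (splitKernel (Kernel.const ℝ (traceTop T μ)) g hg T) := by
  have hE := hμ.totalEnergy_ne_top hd hT
  have hI : internalEnergy μ (-T) T ≠ ⊤ := ne_top_of_le_ne_top hE le_self_add
  have hD := ne_top_of_le_ne_top hE (le_add_self : _ ≤ totalEnergy s T μ)
  have hDtop : deviationSq s (traceTop T μ) ≠ ⊤ := ne_top_of_le_ne_top hD le_self_add
  have hDbot : deviationSq s (traceBot T μ) ≠ ⊤ := ne_top_of_le_ne_top hD le_add_self
  set K := ∫⁻ p, ‖(WithLp.toLp 2 (deriv g p.1) : EuclideanSpace ℝ (Fin d))‖ₑ ^ 2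
    ∂(spaceTime μ (-T) T) with hK
  -- a velocity of finite energy for `μ` provides one for the competitor
  have hadm : Admissible (-T) T (splitKernel μ g hg) := by
    have hlt := hI.lt_top
    simp only [internalEnergy, iInf_lt_iff] at hlt
    obtain ⟨v, hv, hvlt⟩ := hlt
    obtain ⟨v', hv', -⟩ := exists_isVelocity_splitKernel (hg := hg) hgs hfin hv
      (ne_top_of_le_ne_top hvlt.ne le_add_self)
    refine ⟨inferInstance, ?_, v', hv'⟩
    filter_upwards [hμ.1.atomic] with t ht using isAtomic_splitKernel ht
  -- the infimum is taken after the comparison for each velocity, so no minimizing one is needed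
  have henergy : internalEnergy (splitKernel μ g hg) (-T) T ≤
      internalEnergy μ (-T) T + (perimeter μ (T - ε) T + K) := by
    rw [internalEnergy, internalEnergy]
    simp only [ENNReal.iInf_add]
    refine le_iInf₂ fun v hv => ?_
    by_cases hkin : kinetic μ (-T) T v = ⊤
    · simp [hkin]
    obtain ⟨v', hv', hk⟩ := exists_isVelocity_splitKernel (hg := hg) hgs hfin hv hkin
    refine (iInf₂_le v' hv').trans
      ((add_le_add (perimeter_splitKernel_le hd hg hε hεT hg0) hk).trans (le_of_eq ?_))
    ring
  have hfinT : IsFiniteMeasure (trace μ (𝓝[<] T)) := ‹IsFiniteMeasure (traceTop T μ)›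
  have htop : traceTop T (splitKernel μ g hg) =
      splitKernel (Kernel.const ℝ (traceTop T μ)) g hg T :=
    ((isTrace_trace_of_deviationSq hs hDtop).splitKernel hg inf_le_left).trace_eq
      (neBot_nhdsLT_inf_ae T)
  -- near `-T` the competitor coincides with `μ`
  have hbot : traceBot T (splitKernel μ g hg) = traceBot T μ := by
    refine trace_congr ?_
    filter_upwards [Ioo_mem_nhdsGT (show -T < T - ε by linarith)] with t ht
    exact splitKernel_apply_of_eq_zero (hg0 t ht.2.le)
  have hmin := hμ.2 _ hadm
  rw [totalEnergy, totalEnergy, htop, hbot] at hmin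
  have h1 := hmin.trans (add_le_add_left henergy _)
  -- finiteness of the energy of `μ` permits the cancellation
  rw [add_assoc (internalEnergy μ (-T) T), ENNReal.add_le_add_iff_left hI, ← add_assoc,
    ENNReal.add_le_add_iff_right hDbot] at h1
  exact h1

end Minimality

end

/-! ### From quadratic differences to weighted sums -/

section

variable {d : ℕ}

lemma freqNorm_le (k : Fin d → ℤ) {j : Fin d} (hj : ∀ i, |k i| ≤ |k j|) :
    freqNorm k ≤ ENNReal.ofReal (d * |(k j : ℝ)|) := by
  refine ENNReal.ofReal_le_ofReal (Real.sqrt_le_iff.2 ⟨by positivity, ?_⟩)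
  have h1 : ∀ i ∈ Finset.univ, (k i : ℝ) ^ 2 ≤ |(k j : ℝ)| ^ 2 := fun i _ => by
    rw [← sq_abs (k i : ℝ)]
    refine pow_le_pow_left₀ (abs_nonneg _) ?_ 2
    exact_mod_cast hj i
  have hd : (1 : ℝ) ≤ d := by
    have : 0 < d := Fin.pos j
    exact_mod_cast this
  refine (Finset.sum_le_sum h1).trans ?_
  simp only [Finset.sum_const, Finset.card_univ, Fintype.card_fin, nsmul_eq_mul, mul_pow]
  gcongr
  nlinarith

lemma one_le_freqNorm {k : Fin d → ℤ} (hk : k ≠ 0) : 1 ≤ freqNorm k := by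
  obtain ⟨j, hj⟩ := Function.ne_iff.1 hk
  have h1 : (1 : ℝ) ≤ (k j : ℝ) ^ 2 := by
    have : 1 ≤ (k j) ^ 2 := Int.one_le_abs (pow_ne_zero 2 hj) |>.trans_eq (abs_sq _)
    exact_mod_cast this
  have h2 : (k j : ℝ) ^ 2 ≤ ∑ i, (k i : ℝ) ^ 2 :=
    Finset.single_le_sum (f := fun i => (k i : ℝ) ^ 2) (fun i _ => sq_nonneg _) (Finset.mem_univ j)
  rw [freqNorm, ← ENNReal.ofReal_one]
  exact ENNReal.ofReal_le_ofReal (Real.one_le_sqrt.2 (h1.trans h2))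

/-- The dyadic step length at scale `n`. The factor `1/8` puts `2π |m| η` into `[π/4, π/2]` for
frequencies `m` with `2ⁿ ≤ |m| < 2ⁿ⁺¹`. -/
def dyadicStep (n : ℕ) : ℝ := (1 / 2) ^ n / 8

lemma one_half_le_sin_sq {m : ℤ} {n : ℕ} (h1 : (2 : ℝ) ^ n ≤ |(m : ℝ)|)
    (h2 : |(m : ℝ)| ≤ 2 ^ (n + 1)) :
    1 / 2 ≤ Real.sin (2 * Real.pi * (m * dyadicStep n)) ^ 2 := by
  have hpow : (2 : ℝ) ^ n * (1 / 2) ^ n = 1 := by rw [← mul_pow]; norm_num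
  have hη : 0 < dyadicStep n := by unfold dyadicStep; positivity
  have h3 : 1 / 8 ≤ |(m : ℝ)| * dyadicStep n := by
    have := mul_le_mul_of_nonneg_right h1 hη.le
    have h : (2 : ℝ) ^ n * dyadicStep n = 1 / 8 := by rw [dyadicStep, ← mul_div_assoc, hpow]
    linarith
  have h4 : |(m : ℝ)| * dyadicStep n ≤ 1 / 4 := by
    have := mul_le_mul_of_nonneg_right h2 hη.le
    have h : (2 : ℝ) ^ (n + 1) * dyadicStep n = 1 / 4 := by
      rw [dyadicStep, pow_succ, ← mul_div_assoc, mul_right_comm, hpow]; norm_num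
    linarith
  have h5 : Real.sin (2 * Real.pi * (m * dyadicStep n)) ^ 2 =
      Real.sin (2 * Real.pi * (|(m : ℝ)| * dyadicStep n)) ^ 2 := by
    rcases abs_choice (m : ℝ) with h | h <;> rw [h]
    rw [neg_mul, mul_neg, Real.sin_neg, neg_sq]
  have hpi := Real.pi_pos
  have h6 : √2 / 2 ≤ Real.sin (2 * Real.pi * (|(m : ℝ)| * dyadicStep n)) := by
    rw [← Real.sin_pi_div_four]
    refine Real.sin_le_sin_of_le_of_le_pi_div_two (by linarith) ?_ ?_ <;> nlinarith
  rw [h5]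
  refine le_trans (le_of_eq ?_) (pow_le_pow_left₀ (by positivity) h6 2)
  rw [div_pow, Real.sq_sqrt (by norm_num)]
  norm_num

/-- The weight `|k|^q` is bounded by the term in which `j` is the direction of the largest component
of `k` and `n` is its dyadic scale. -/
lemma rpow_freqNorm_le {k : Fin d → ℤ} (hk : k ≠ 0) {q : ℝ} (hq : 0 ≤ q) :
    freqNorm k ^ q ≤ ENNReal.ofReal (2 * (2 * d) ^ q) * ∑' n : ℕ, ∑ j,
      ENNReal.ofReal ((2 ^ n) ^ q) *
        ENNReal.ofReal (Real.sin (2 * Real.pi * (k j * dyadicStep n)) ^ 2) := by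
  obtain ⟨i₀, hi₀⟩ := Function.ne_iff.1 hk
  obtain ⟨j, -, hj⟩ := Finset.exists_max_image Finset.univ (fun i => |k i|) ⟨i₀, Finset.mem_univ _⟩
  have hkj : k j ≠ 0 := fun h0 => hi₀ (by
    have := hj i₀ (Finset.mem_univ _)
    rw [h0, abs_zero] at this
    exact abs_nonpos_iff.1 this)
  set n := Nat.log 2 (k j).natAbs with hn
  have hcast : (((k j).natAbs : ℕ) : ℝ) = |(k j : ℝ)| := by
    rw [Nat.cast_natAbs, Int.cast_abs]
  have h1 : (2 : ℝ) ^ n ≤ |(k j : ℝ)| := by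
    rw [← hcast]
    exact_mod_cast Nat.pow_log_le_self 2 (Int.natAbs_ne_zero.2 hkj)
  have h2 : |(k j : ℝ)| ≤ 2 ^ (n + 1) := by
    rw [← hcast]
    exact_mod_cast (Nat.lt_pow_succ_log_self one_lt_two _).le
  have h3 := one_half_le_sin_sq h1 h2
  set S := Real.sin (2 * Real.pi * (k j * dyadicStep n)) ^ 2 with hS
  calc freqNorm k ^ q ≤ (ENNReal.ofReal (d * |(k j : ℝ)|)) ^ q :=
        ENNReal.rpow_le_rpow (freqNorm_le k fun i => hj i (Finset.mem_univ _)) hq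
    _ = ENNReal.ofReal ((d * |(k j : ℝ)|) ^ q) := ENNReal.ofReal_rpow_of_nonneg (by positivity) hq
    _ ≤ ENNReal.ofReal (2 * (2 * d) ^ q * ((2 ^ n) ^ q * S)) := by
        refine ENNReal.ofReal_le_ofReal ?_
        have h4 : (d * |(k j : ℝ)|) ^ q ≤ (2 * d * 2 ^ n) ^ q := by
          refine Real.rpow_le_rpow (by positivity) ?_ hq
          rw [pow_succ] at h2
          nlinarith [(Nat.cast_nonneg d : (0 : ℝ) ≤ d)]
        rw [Real.mul_rpow (x := 2 * (d : ℝ)) (by positivity) (by positivity)] at h4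
        have h5 : 0 ≤ (2 * (d : ℝ)) ^ q * (2 ^ n) ^ q := by positivity
        nlinarith
    _ = ENNReal.ofReal (2 * (2 * d) ^ q) *
          (ENNReal.ofReal ((2 ^ n) ^ q) * ENNReal.ofReal S) := by
        rw [ENNReal.ofReal_mul (by positivity),
          ENNReal.ofReal_mul (p := (2 ^ n) ^ q) (by positivity)]
    _ ≤ _ := by
        gcongr
        refine le_trans ?_ (ENNReal.le_tsum n)
        exact Finset.single_le_sum (f := fun j => ENNReal.ofReal ((2 ^ n) ^ q) *
          ENNReal.ofReal (Real.sin (2 * Real.pi * (k j * dyadicStep n)) ^ 2))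
          (fun _ _ => zero_le) (Finset.mem_univ j)

/-- A Hölder bound of order `p` on the quadratic differences in the coordinate directions gives a
finite sum with every weight `|k|^q`, `q < p`. -/
theorem tsum_rpow_freqNorm_ne_top {a : (Fin d → ℤ) → ℝ≥0∞} (ha : a 0 = 0) {A : ℝ≥0∞} (hA : A ≠ ⊤)
    {p q : ℝ} (hq : 0 ≤ q) (hqp : q < p)
    (h : ∀ j, ∀ η ∈ Set.Ioc (0 : ℝ) 1,
      ∑' k, a k * ENNReal.ofReal (Real.sin (2 * Real.pi * (k j * η)) ^ 2) ≤
        A * ENNReal.ofReal (η ^ p)) :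
    ∑' k, freqNorm k ^ q * a k ≠ ⊤ := by
  set c := ENNReal.ofReal (2 * (2 * d) ^ q)
  have hp : 0 < p := hq.trans_lt hqp
  have hstep : ∀ n, dyadicStep n ∈ Set.Ioc (0 : ℝ) 1 := fun n => by
    have : (1 / 2 : ℝ) ^ n ≤ 1 := pow_le_one₀ (by norm_num) (by norm_num)
    refine ⟨by unfold dyadicStep; positivity, ?_⟩
    unfold dyadicStep; linarith
  have h1 : ∑' k, freqNorm k ^ q * a k ≤ c * ∑' n : ℕ, ∑ j : Fin d,
      ENNReal.ofReal ((2 ^ n) ^ q) * (A * ENNReal.ofReal (dyadicStep n ^ p)) := by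
    calc ∑' k, freqNorm k ^ q * a k
        ≤ ∑' k, c * ∑' n : ℕ, ∑ j, ENNReal.ofReal ((2 ^ n) ^ q) * (a k *
            ENNReal.ofReal (Real.sin (2 * Real.pi * (k j * dyadicStep n)) ^ 2)) := by
          refine ENNReal.tsum_le_tsum fun k => ?_
          by_cases hk : k = 0
          · simp [hk, ha]
          refine (mul_le_mul_left (rpow_freqNorm_le hk hq) _).trans (le_of_eq ?_)
          rw [mul_assoc, ← ENNReal.tsum_mul_right]
          congr 1
          refine tsum_congr fun n => ?_
          rw [Finset.sum_mul]
          refine Finset.sum_congr rfl fun j _ => ?_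
          ring
      _ = c * ∑' n : ℕ, ∑ j : Fin d, ENNReal.ofReal ((2 ^ n) ^ q) * ∑' k, (a k *
            ENNReal.ofReal (Real.sin (2 * Real.pi * (k j * dyadicStep n)) ^ 2)) := by
          rw [ENNReal.tsum_mul_left, ENNReal.tsum_comm]
          congr 1
          refine tsum_congr fun n => ?_
          rw [Summable.tsum_finsetSum fun j _ => ENNReal.summable]
          simp only [ENNReal.tsum_mul_left]
      _ ≤ _ := by
          gcongr with n j
          exact h _ _ (hstep n)
  refine ne_top_of_le_ne_top ?_ h1
  have h2 : ∀ n : ℕ, ∑ _j : Fin d, ENNReal.ofReal ((2 ^ n) ^ q) *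
      (A * ENNReal.ofReal (dyadicStep n ^ p)) ≤
      d * A * ENNReal.ofReal (1 * ((2 : ℝ) ^ (q - p)) ^ n) := by
    intro n
    rw [Finset.sum_const, Finset.card_univ, Fintype.card_fin, nsmul_eq_mul, mul_assoc,
      mul_left_comm _ A, ← ENNReal.ofReal_mul (by positivity)]
    refine mul_le_mul_right (mul_le_mul_right (ENNReal.ofReal_le_ofReal ?_) _) _
    have h3 : dyadicStep n ^ p ≤ ((1 / 2) ^ n) ^ p := by
      refine Real.rpow_le_rpow (hstep n).1.le ?_ hp.le
      have : (0 : ℝ) ≤ (1 / 2) ^ n := by positivity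
      unfold dyadicStep; linarith
    have h4 : ((2 : ℝ) ^ (q - p)) ^ n = (2 ^ n) ^ q * ((1 / 2) ^ n) ^ p := by
      have h5 : (1 / 2 : ℝ) ^ n = ((2 : ℝ) ^ n)⁻¹ := by rw [div_pow, one_pow, one_div]
      rw [h5, Real.inv_rpow (by positivity), ← Real.rpow_neg (by positivity),
        ← Real.rpow_add (by positivity), ← sub_eq_add_neg, ← Real.rpow_natCast,
        ← Real.rpow_natCast, ← Real.rpow_mul (by positivity), ← Real.rpow_mul (by positivity),
        mul_comm]
    rw [one_mul, h4]
    exact mul_le_mul_of_nonneg_left h3 (by positivity)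
  refine ENNReal.mul_ne_top ENNReal.ofReal_ne_top (ne_top_of_le_ne_top ?_ (ENNReal.tsum_le_tsum h2))
  rw [ENNReal.tsum_mul_left]
  exact ENNReal.mul_ne_top (ENNReal.mul_ne_top (ENNReal.natCast_ne_top d) hA)
    (tsum_ofReal_geometric_ne_top zero_le_one (by positivity)
      (Real.rpow_lt_one_of_one_lt_of_neg one_lt_two (by linarith)))

end

/-! ### Regularity of the boundary measure -/

section

variable {d : ℕ} {s T : ℝ} {μ : Kernel ℝ (UnitAddTorus (Fin d))}

/-- The energy of the boundary measure which is lost in the average of its translates by `±h` is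
controlled by the energy needed to split the measure in the time interval `(T - ε, T)`. -/
theorem IsMinimizer.exists_tsum_sin_le (hd : 1 ≤ d) (hs : 0 < s) (hT : 0 < T)
    (hμ : IsMinimizer s T μ) : ∃ A : ℝ≥0∞, A ≠ ⊤ ∧ ∀ (ε : ℝ) (h : Fin d → ℝ), 0 < ε → ε < 2 * T →
      ∑' k, freqNorm k ^ (-2 * s) * ‖devCoeff (traceTop T μ) k‖ₑ ^ 2 *
        ENNReal.ofReal (Real.sin (2 * Real.pi * ∑ i, k i * h i) ^ 2) ≤
      perimeter μ (T - ε) T +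
        A * ENNReal.ofReal (‖(WithLp.toLp 2 h : EuclideanSpace ℝ (Fin d))‖ ^ 2 / ε) := by
  have := hμ.1.finite
  obtain ⟨A, hA, hAle⟩ := exists_lintegral_deriv_endRamp_le μ
  refine ⟨A, hA, fun ε h hε hεT => ?_⟩
  have hE := hμ.totalEnergy_ne_top hd hT
  have hDtop : deviationSq s (traceTop T μ) ≠ ⊤ :=
    ne_top_of_le_ne_top hE (le_self_add.trans le_add_self)
  have : IsFiniteMeasure (traceTop T μ) := (isTrace_trace_of_deviationSq hs hDtop).1
  set a : (Fin d → ℤ) → ℝ≥0∞ := fun k => freqNorm k ^ (-2 * s) * ‖devCoeff (traceTop T μ) k‖ₑ ^ 2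
  set x : (Fin d → ℤ) → ℝ := fun k => 2 * Real.pi * ∑ i, k i * h i
  have hgs : ContDiff ℝ ∞ fun t => endRamp T ε t • h :=
    (contDiff_endRamp T ε).smul contDiff_const
  have hg := hgs.continuous
  have hK := hAle T ε h hε
  have h1 := hμ.deviationSq_le hd hs hT hε hεT hgs hg
    (fun t ht => by rw [endRamp_of_le hε ht, zero_smul])
    (ne_top_of_le_ne_top (ENNReal.mul_ne_top hA ENNReal.ofReal_ne_top) hK)
  have hcos : deviationSq s (splitKernel (Kernel.const ℝ (traceTop T μ)) _ hg T) =
      ∑' k, a k * ENNReal.ofReal (Real.cos (x k) ^ 2) := by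
    rw [deviationSq_eq]
    refine tsum_congr fun k => ?_
    rw [devCoeff_splitKernel, endRamp_self, one_smul, enorm_mul, mul_pow,
      ← ofReal_norm ((Real.cos _ : ℝ) : ℂ), Complex.norm_real, Real.norm_eq_abs,
      ← ENNReal.ofReal_pow (abs_nonneg _), sq_abs]
    ring
  have hsum : deviationSq s (traceTop T μ) =
      ∑' k, a k * ENNReal.ofReal (Real.sin (x k) ^ 2) +
        ∑' k, a k * ENNReal.ofReal (Real.cos (x k) ^ 2) := by
    rw [deviationSq_eq, ← ENNReal.tsum_add]
    refine tsum_congr fun k => ?_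
    rw [← mul_add, ← ENNReal.ofReal_add (sq_nonneg _) (sq_nonneg _), Real.sin_sq_add_cos_sq,
      ENNReal.ofReal_one, mul_one]
  rw [hcos, hsum] at h1
  rw [hsum] at hDtop
  exact ((ENNReal.add_le_add_iff_right (ENNReal.add_ne_top.1 hDtop).2).1 h1).trans
    (add_le_add_right hK _)

/-- The scaling hypothesis bounds the perimeter near the final time. -/
lemma exists_perimeter_le {β : ℝ}
    (hloc : Filter.limsup (fun ε : ℝ => ENNReal.ofReal (ε ^ (-β)) * internalEnergy μ (T - ε) T)
      (𝓝[>] (0 : ℝ)) < ⊤) :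
    ∃ C : ℝ≥0∞, C ≠ ⊤ ∧ ∃ ε₀ > 0, ∀ ε ∈ Set.Ioo 0 ε₀,
      perimeter μ (T - ε) T ≤ C * ENNReal.ofReal (ε ^ β) := by
  obtain ⟨C, hC1, hC2⟩ := exists_between hloc
  obtain ⟨ε₀, hε₀, hsub⟩ := mem_nhdsGT_iff_exists_Ioo_subset.1 (eventually_lt_of_limsup_lt hC1)
  refine ⟨C, hC2.ne, ε₀, hε₀, fun ε hε => ?_⟩
  have h1 : ENNReal.ofReal (ε ^ (-β)) * internalEnergy μ (T - ε) T < C := hsub hε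
  have h2 : perimeter μ (T - ε) T ≤ internalEnergy μ (T - ε) T :=
    le_iInf₂ fun v _ => le_self_add
  have h3 : ENNReal.ofReal (ε ^ β) * ENNReal.ofReal (ε ^ (-β)) = 1 := by
    rw [← ENNReal.ofReal_mul (Real.rpow_nonneg hε.1.le _), ← Real.rpow_add hε.1, add_neg_cancel,
      Real.rpow_zero, ENNReal.ofReal_one]
  calc perimeter μ (T - ε) T ≤ internalEnergy μ (T - ε) T := h2
    _ = ENNReal.ofReal (ε ^ β) * (ENNReal.ofReal (ε ^ (-β)) * internalEnergy μ (T - ε) T) := by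
        rw [← mul_assoc, h3, one_mul]
    _ ≤ ENNReal.ofReal (ε ^ β) * C := by gcongr
    _ = _ := mul_comm _ _

/-- The quadratic differences of the boundary measure decay with order `2β/(1+β)`: this is the
choice `ε = η ^ (2/(1+β))`, which balances `ε ^ β` against `η² / ε`. -/
theorem IsMinimizer.exists_tsum_sin_le_rpow (hd : 1 ≤ d) (hs : 0 < s) (hT : 0 < T) {β : ℝ}
    (hβ : 0 < β) (hμ : IsMinimizer s T μ)
    (hloc : Filter.limsup (fun ε : ℝ => ENNReal.ofReal (ε ^ (-β)) * internalEnergy μ (T - ε) T)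
      (𝓝[>] (0 : ℝ)) < ⊤) :
    ∃ A : ℝ≥0∞, A ≠ ⊤ ∧ ∀ j, ∀ η ∈ Set.Ioc (0 : ℝ) 1,
      ∑' k, freqNorm k ^ (-2 * s) * ‖devCoeff (traceTop T μ) k‖ₑ ^ 2 *
        ENNReal.ofReal (Real.sin (2 * Real.pi * (k j * η)) ^ 2) ≤
      A * ENNReal.ofReal (η ^ (2 * β / (1 + β))) := by
  obtain ⟨A, hA, hAle⟩ := hμ.exists_tsum_sin_le hd hs hT
  obtain ⟨C, hC, ε₀, hε₀, hCle⟩ := exists_perimeter_le hloc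
  have hD : deviationSq s (traceTop T μ) ≠ ⊤ :=
    ne_top_of_le_ne_top (hμ.totalEnergy_ne_top hd hT) (le_self_add.trans le_add_self)
  set D := deviationSq s (traceTop T μ)
  set p := 2 * β / (1 + β) with hp
  have hp0 : 0 < p := by positivity
  set e := 2 / (1 + β) with he
  have he0 : 0 < e := by positivity
  have heβ : e * β = p := by rw [he, hp]; ring
  have hep : 2 - e = p := by rw [he, hp]; field_simp; ring
  set m := min ε₀ (2 * T)
  have hm : 0 < m := lt_min hε₀ (by linarith)
  refine ⟨(C + A) + D * ENNReal.ofReal (m ^ (-β)), by finiteness, fun j η hη => ?_⟩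
  have hηe : 0 < η ^ e := Real.rpow_pos_of_pos hη.1 e
  rw [add_mul]
  by_cases hsmall : η ^ e < m
  · refine le_trans ?_ le_self_add
    have h1 := hAle (η ^ e) (Pi.single j η) hηe (hsmall.trans_le (min_le_right _ _))
    have h2 : ∀ k : Fin d → ℤ, ∑ i, (k i : ℝ) * (Pi.single j η : Fin d → ℝ) i = k j * η := by
      intro k
      simp [Pi.single_apply]
    have h3 : ‖(WithLp.toLp 2 (Pi.single j η) : EuclideanSpace ℝ (Fin d))‖ ^ 2 / η ^ e = η ^ p := by
      have h4 : ‖(WithLp.toLp 2 (Pi.single j η) : EuclideanSpace ℝ (Fin d))‖ = η := by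
        have h5 : ‖(WithLp.toLp 2 (Pi.single j η) : EuclideanSpace ℝ (Fin d))‖ = ‖η‖ :=
          PiLp.norm_single 2 (fun _ : Fin d => ℝ) j η
        rw [h5, Real.norm_of_nonneg hη.1.le]
      rw [h4, ← Real.rpow_natCast η 2, ← Real.rpow_sub hη.1, ← hep]
      norm_num
    have h4 : (η ^ e) ^ β = η ^ p := by rw [← Real.rpow_mul hη.1.le, heβ]
    simp only [h2, h3] at h1
    refine h1.trans ?_
    rw [add_mul, ← h4]
    exact add_le_add_left (hCle _ ⟨hηe, hsmall.trans_le (min_le_left _ _)⟩) _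
  · -- for large `η` the total deviation is a sufficient bound
    refine le_trans ?_ le_add_self
    have h1 : m ^ β ≤ η ^ p := by
      rw [← heβ, Real.rpow_mul hη.1.le]
      exact Real.rpow_le_rpow hm.le (not_lt.1 hsmall) hβ.le
    have h2 : (1 : ℝ≥0∞) ≤ ENNReal.ofReal (m ^ (-β)) * ENNReal.ofReal (η ^ p) := by
      rw [← ENNReal.ofReal_mul (by positivity), ← ENNReal.ofReal_one]
      refine ENNReal.ofReal_le_ofReal ?_
      rw [Real.rpow_neg hm.le]
      exact (le_inv_mul_iff₀ (by positivity)).2 (by simpa using h1)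
    calc _ ≤ ∑' k, freqNorm k ^ (-2 * s) * ‖devCoeff (traceTop T μ) k‖ₑ ^ 2 := by
          refine ENNReal.tsum_le_tsum fun k => mul_le_of_le_one_right' ?_
          rw [← ENNReal.ofReal_one]
          exact ENNReal.ofReal_le_ofReal (Real.sin_sq_le_one _)
      _ = D * 1 := (mul_one _).symm
      _ ≤ D * (ENNReal.ofReal (m ^ (-β)) * ENNReal.ofReal (η ^ p)) := by gcongr
      _ = _ := (mul_assoc _ _ _).symm

end

end

end BranchedTransport

open BranchedTransport

theorem mainTheorem5 {d : ℕ} (hd : 1 ≤ d) {s T β : ℝ} (hs0 : 0 < s) (hs1 : s < 1) (hT : 0 < T)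
    (hβ0 : 0 < β) (hβ1 : β < 1)
    (μ : ProbabilityTheory.Kernel ℝ (UnitAddTorus (Fin d)))
    (hμ : BranchedTransport.IsMinimizer s T μ)
    (hsymm : BranchedTransport.IsSymmetric T μ)
    (hloc : Filter.limsup
      (fun ε : ℝ => ENNReal.ofReal (ε ^ (-β)) * BranchedTransport.internalEnergy μ (T - ε) T)
      (𝓝[>] (0 : ℝ)) < ⊤) :
    ∀ α : ℝ, α < 2 * (1 - s) + 2 * β / (1 + β) →
      BranchedTransport.deviationSq ((2 - α) / 2) (BranchedTransport.traceTop T μ) < ⊤ := by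
  intro α hα
  have hD : deviationSq s (traceTop T μ) ≠ ⊤ :=
    ne_top_of_le_ne_top (hμ.totalEnergy_ne_top hd hT) (le_self_add.trans le_add_self)
  have h0 : devCoeff (traceTop T μ) 0 = 0 := devCoeff_zero_of_deviationSq hs0 hD
  obtain ⟨A, hA, hAle⟩ := hμ.exists_tsum_sin_le_rpow hd hs0 hT hβ0 hloc
  have hp : 0 < 2 * β / (1 + β) := by positivity
  have hsum := tsum_rpow_freqNorm_ne_top (q := max (α - 2 + 2 * s) 0) (by simp [h0]) hA
    (le_max_right _ _) (max_lt (by linarith) hp) hAle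
  refine lt_of_le_of_lt (ENNReal.tsum_le_tsum fun k => ?_) hsum.lt_top
  change freqNorm k ^ (-2 * ((2 - α) / 2)) * ‖devCoeff (traceTop T μ) k‖ₑ ^ 2 ≤ _
  -- the weight at `k = 0` may be infinite, but there the coefficient vanishes
  by_cases hk : k = 0
  · simp [hk, h0]
  rw [← mul_assoc]
  have h1 := one_le_freqNorm hk
  have htop : freqNorm k ≠ ⊤ := ENNReal.ofReal_ne_top
  rw [← ENNReal.rpow_add _ _ (zero_lt_one.trans_le h1).ne' htop]
  gcongr
  linarith [le_max_left (α - 2 + 2 * s) 0]
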